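/- Let $n\ge 0$ be an integer and $\lambda\in\mathbb C$. Let $C^\infty(\mathbb R^n)$ be the algebra of smooth complex-valued functions of $u=(u_1,\dots,u_n)$, where $\mathbb R^n=\{[1,u_1,\dots,u_n]\}$ is the big cell of $\mathbb{RP}^n$. Let $\mathcal P=C^\infty(\mathbb R^n)[\xi_1,\dots,\xi_n]$ be the algebra of smooth functions on $T^*\mathbb R^n$ that are polynomial along the fibres, graded by the degree in $\xi$, $\mathcal P=\bigoplus_d\mathcal P^d$, with Poisson bracket $\{p,q\}=\sum_i\left(\frac{\partial p}{\partial \xi_i}\frac{\partial q}{\partial u_i}-\frac{\partial p}{\partial u_i}\frac{\partial q}{\partial \xi_i}\right)$. Let $\mathcal D^\lambda$ be the algebra of smooth linear differential operators on $\lambda$-densities on $\mathbb R^n$; identifying $f\,|du|^\lambda$ with $f$, it consists of the finite sums $\sum_a f_a\,\partial_u^a$ with $f_a\in C^\infty(\mathbb R^n)$. For $x\in\mathfrak{sl}_{n+1}(\mathbb R)$ let $\eta^x=\sum_i\eta^x_i\,\partial/\partial u_i$ be the vector field on $\mathbb R^n$ induced by the action on $\mathbb{RP}^n$, $\mu^x=\sum_i\eta^x_i\xi_i$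 its symbol, and $\eta^x_\lambda=\eta^x+\lambda\operatorname{div}\eta^x$ its Lie derivative on $\lambda$-densities. There is exactly one $\mathbb C$-linear isomorphism $\mathcal Q_\lambda:\mathcal P\to\mathcal D^\lambda$ such that, for all $d$ and all $\varphi\in\mathcal P^d$, the operator $\mathcal Q_\lambda(\varphi)$ has order at most $d$ and degree-$d$ principal symbol $\varphi$, and such that $\mathcal Q_\lambda(\{\mu^x,\varphi\})=[\eta^x_\lambda,\mathcal Q_\lambda(\varphi)]$ for all $x\in\mathfrak{sl}_{n+1}(\mathbb R)$ and $\varphi\in\mathcal P$. Let $\mathcal Q_{\lambda,t}:\mathcal P[t]\to\mathcal D^\lambda[t]$ be the $\mathbb C[t]$-linear map with $\mathcal Q_{\lambda,t}(\varphi)=t^d\mathcal Q_\lambda(\varphi)$ for $\varphi\in\mathcal P^d$. It is injective, and one puts $\Phi\star_\lambda\Psi=\mathcal Q_{\lambda,t}^{-1}\bigl(\mathcal Q_{\lambda,t}(\Phi)\,\mathcal Q_{\lambda,t}(\Psi)\bigr)$. Then, for every $\phi\in C^\infty(\mathbb R^n)$ and every $\psi\in\mathbb C[\xi_1,\dots,\xi_n]$,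 the product $\mathcal Q_{\lambda,t}(\phi)\,\mathcal Q_{\lambda,t}(\psi)$ lies in the image of $\mathcal Q_{\lambda,t}$ and $$\phi\star_\lambda\psi=\mathbf g_\lambda(\phi\psi),\qquad \mathbf g_\lambda=1+\sum_{d\ge1}g_{\lambda,d}\,D^d\,t^d,\qquad g_{\lambda,d}=\frac1{d!}\prod_{j=0}^{d-1}\frac{-E-j-\lambda(n+1)}{2E+j+n+1},$$ where $D=\sum_{i=1}^n\frac{\partial^2}{\partial u_i\,\partial\xi_i}$, $E=\sum_{i=1}^n\xi_i\frac{\partial}{\partial\xi_i}$, and $\frac{1}{2E+j+n+1}$ is the inverse of the (invertible) operator $2E+j+n+1$ on $\mathcal P$. -/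

import Mathlib

open scoped ContDiff Polynomial

noncomputable section

namespace ProjStar

/-- The algebra of smooth complex-valued functions on the big cell `ℝⁿ`. -/
def smoothSubalgebra (n : ℕ) : Subalgebra ℂ ((Fin n → ℝ) → ℂ) where
  carrier := {f | ContDiff ℝ ∞ f}
  mul_mem' hf hg := by
    rw [Set.mem_ofPred_eq] at hf hg ⊢
    exact hf.mul hg
  add_mem' hf hg := by
    rw [Set.mem_ofPred_eq] at hf hg ⊢
    exact hf.add hg
  algebraMap_mem' c := (contDiff_const : ContDiff ℝ ∞ fun _ : Fin n → ℝ => c)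

/-- The type of smooth complex-valued functions on the big cell `ℝⁿ`. -/
def Smooth (n : ℕ) : Type := smoothSubalgebra n

instance (n : ℕ) : CommRing (Smooth n) := inferInstanceAs (CommRing (smoothSubalgebra n))

instance (n : ℕ) : Algebra ℂ (Smooth n) := inferInstanceAs (Algebra ℂ (smoothSubalgebra n))

instance (n : ℕ) : CoeFun (Smooth n) fun _ => (Fin n → ℝ) → ℂ := ⟨fun f => f.1⟩

theorem Smooth.ext {n : ℕ} {f g : Smooth n} (h : ∀ u, f u = g u) : f = g :=
  Subtype.ext (funext h)

theorem Smooth.contDiff {n : ℕ} (f : Smooth n) : ContDiff ℝ ∞ (fun u => f u) := f.2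

theorem Smooth.differentiableAt {n : ℕ} (f : Smooth n) (u : Fin n → ℝ) :
    DifferentiableAt ℝ (fun u => f u) u := f.contDiff.differentiable (by simp) u

/-- The partial derivative `∂/∂uᵢ` on smooth functions. -/
def pd {n : ℕ} (i : Fin n) : Module.End ℂ (Smooth n) where
  toFun f := ⟨fun u => fderiv ℝ (fun v => f v) u (Pi.single i 1),
    show ContDiff ℝ ∞ fun u => fderiv ℝ (fun v => f v) u (Pi.single i 1) from
      (ContDiff.fderiv_right (m := ∞) f.contDiff (by simp)).clm_apply contDiff_const⟩
  map_add' f g := Smooth.ext fun u => by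
    change fderiv ℝ (fun v => f v + g v) u (Pi.single i 1) =
      fderiv ℝ (fun v => f v) u (Pi.single i 1) + fderiv ℝ (fun v => g v) u (Pi.single i 1)
    rw [fderiv_fun_add (f.differentiableAt u) (g.differentiableAt u)]
    rfl
  map_smul' c f := Smooth.ext fun u => by
    change fderiv ℝ (fun v => c • f v) u (Pi.single i 1) =
      c • fderiv ℝ (fun v => f v) u (Pi.single i 1)
    rw [fderiv_fun_const_smul (f.differentiableAt u)]
    rfl

/-- The coordinate function `uᵢ`. -/
def coord {n : ℕ} (i : Fin n) : Smooth n :=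
  ⟨fun u => ((u i : ℝ) : ℂ), show ContDiff ℝ ∞ fun u : Fin n → ℝ => ((u i : ℝ) : ℂ) from
    Complex.ofRealCLM.contDiff.comp (contDiff_apply ℝ ℝ i)⟩

/-- Multiplication by a smooth function, as an operator. -/
def mulOp {n : ℕ} (f : Smooth n) : Module.End ℂ (Smooth n) := LinearMap.mulLeft ℂ f

/-- Smooth functions on `T*ℝⁿ`, polynomial along the fibres: polynomials in the conjugate momenta
`ξ₁, …, ξₙ` (the variables `X i`) whose coefficients are smooth functions of `u`. -/
abbrev Pol (n : ℕ) : Type := MvPolynomial (Fin n) (Smooth n)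

/-- Applying a family of linear maps to the coefficients of an element of `Pol n`:
`Σ fₐ ξᵃ ↦ Σ (L a fₐ) ξᵃ`. -/
def onCoeff {n : ℕ} (L : (Fin n →₀ ℕ) → Module.End ℂ (Smooth n)) : Module.End ℂ (Pol n) where
  toFun p := ∑ a ∈ p.support, MvPolynomial.monomial a (L a (p.coeff a))
  map_add' p q := by
    classical
    ext1 b
    simp only [MvPolynomial.coeff_sum, MvPolynomial.coeff_monomial, MvPolynomial.coeff_add,
      Finset.sum_ite_eq', MvPolynomial.mem_support_iff]
    split_ifs <;> simp_all [← map_add]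
  map_smul' c p := by
    classical
    ext1 b
    simp only [MvPolynomial.coeff_sum, MvPolynomial.coeff_monomial, MvPolynomial.coeff_smul,
      Finset.sum_ite_eq', MvPolynomial.mem_support_iff, RingHom.id_apply]
    split_ifs <;> simp_all

theorem coeff_onCoeff {n : ℕ} (L : (Fin n →₀ ℕ) → Module.End ℂ (Smooth n)) (p : Pol n)
    (b : Fin n →₀ ℕ) : (onCoeff L p).coeff b = L b (p.coeff b) := by
  classical
  simp only [onCoeff, LinearMap.coe_mk, AddHom.coe_mk, MvPolynomial.coeff_sum,
    MvPolynomial.coeff_monomial, Finset.sum_ite_eq', MvPolynomial.mem_support_iff]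
  split_ifs <;> simp_all

/-- `∂/∂uᵢ` on `Pol n`. -/
def dU {n : ℕ} (i : Fin n) : Module.End ℂ (Pol n) := onCoeff fun _ => pd i

/-- `∂/∂ξᵢ` on `Pol n`. -/
def dXi {n : ℕ} (i : Fin n) : Module.End ℂ (Pol n) :=
  (MvPolynomial.pderiv (R := Smooth n) i).toLinearMap.restrictScalars ℂ

/-- The fibrewise Euler vector field `E = Σ ξᵢ ∂/∂ξᵢ`. -/
def euler (n : ℕ) : Module.End ℂ (Pol n) :=
  ∑ i, LinearMap.mulLeft ℂ (MvPolynomial.X i : Pol n) * dXi i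

/-- `D = Σ ∂²/∂uᵢ∂ξᵢ`. -/
def opD (n : ℕ) : Module.End ℂ (Pol n) := ∑ i, dU i * dXi i

/-- The Poisson bracket, normalised by `{ξᵢ, uⱼ} = δᵢⱼ`. -/
def poisson {n : ℕ} (p q : Pol n) : Pol n := ∑ i, (dXi i p * dU i q - dU i p * dXi i q)

/-- The algebra of smooth linear differential operators on `λ`-densities on `ℝⁿ`. A `λ`-density
`f |du₁⋯duₙ|^λ` is identified with the function `f`, so that differential operators on
`λ`-densities are those on functions; the parameter `λ` enters through the Lie derivative
`lieDensity`. -/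
def DiffOp (n : ℕ) : Subalgebra ℂ (Module.End ℂ (Smooth n)) :=
  Algebra.adjoin ℂ (Set.range mulOp ∪ Set.range pd)

/-- The operator `∂ᵃ = ∂₁^{a₁} ⋯ ∂ₙ^{aₙ}`. -/
def pdPow {n : ℕ} (a : Fin n →₀ ℕ) : Module.End ℂ (Smooth n) :=
  (List.ofFn fun i => pd i ^ a i).prod

/-- The differential operator `Σ fₐ ∂ᵃ` with full symbol `Σ fₐ ξᵃ`. -/
def ofFullSymbol {n : ℕ} (p : Pol n) : Module.End ℂ (Smooth n) :=
  ∑ a ∈ p.support, mulOp (p.coeff a) * pdPow a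

/-- `T` is a differential operator of order at most `d`, and its principal symbol (the part of its
full symbol that is homogeneous of degree `d`) is `φ`. -/
def HasPrincipalSymbol {n : ℕ} (d : ℕ) (T : Module.End ℂ (Smooth n)) (φ : Pol n) : Prop :=
  φ.IsHomogeneous d ∧ ∃ r : Pol n, (∀ a ∈ r.support, a.degree < d) ∧ T = ofFullSymbol (φ + r)

/-- The homogeneous coordinates `(u₀, u₁, …, uₙ)` on the big cell `u₀ = 1`. -/
def homCoord (n : ℕ) : Fin (n + 1) → Smooth n := Fin.cons 1 coord

/-- The components of the linear vector field `x · (u₀, …, uₙ)ᵀ` along the big cell. -/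
def linComp {n : ℕ} (x : Matrix (Fin (n + 1)) (Fin (n + 1)) ℝ) (k : Fin (n + 1)) : Smooth n :=
  ∑ j, (x k j : ℂ) • homCoord n j

/-- The `i`-th component (the coefficient of `∂/∂uᵢ`) of the vector field `ηˣ` on the big cell that
is induced by the action of `x` on projective space: the derivative at `s = 0` of the `i`-th affine
coordinate of `exp (s x) · [1, u₁, …, uₙ]`. -/
def vf {n : ℕ} (x : Matrix (Fin (n + 1)) (Fin (n + 1)) ℝ) (i : Fin n) : Smooth n :=
  linComp x i.succ - coord i * linComp x 0

/-- The momentum function `μˣ = Σ ηˣᵢ ξᵢ`, the principal symbol of `ηˣ`. -/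
def momentum {n : ℕ} (x : Matrix (Fin (n + 1)) (Fin (n + 1)) ℝ) : Pol n :=
  ∑ i, MvPolynomial.C (vf x i) * MvPolynomial.X i

/-- The Lie derivative of `λ`-densities along `ηˣ`, which is `Σ ηˣᵢ ∂ᵢ + λ div ηˣ`. -/
def lieDensity {n : ℕ} (lam : ℂ) (x : Matrix (Fin (n + 1)) (Fin (n + 1)) ℝ) :
    Module.End ℂ (Smooth n) :=
  ∑ i, mulOp (vf x i) * pd i + lam • mulOp (∑ i, pd i (vf x i))

/-- `Q` is an `sl(n+1, ℝ)`-equivariant quantization map from `Pol n` to differential operators on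
`λ`-densities: a linear isomorphism (this is in the type of `Q`) that respects principal symbols
and intertwines the actions of `sl(n+1, ℝ)`. -/
structure IsEquivariantQuantization {n : ℕ} (lam : ℂ) (Q : Pol n ≃ₗ[ℂ] DiffOp n) : Prop where
  symbol : ∀ (d : ℕ) (φ : Pol n), φ.IsHomogeneous d →
    HasPrincipalSymbol d (Q φ : Module.End ℂ (Smooth n)) φ
  equivariant : ∀ (x : LieAlgebra.SpecialLinear.sl (Fin (n + 1)) ℝ) (φ : Pol n),
    (Q (poisson (momentum (x : Matrix (Fin (n + 1)) (Fin (n + 1)) ℝ)) φ) :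
        Module.End ℂ (Smooth n)) =
      lieDensity lam (x : Matrix (Fin (n + 1)) (Fin (n + 1)) ℝ) * (Q φ : Module.End ℂ (Smooth n)) -
        (Q φ : Module.End ℂ (Smooth n)) *
          lieDensity lam (x : Matrix (Fin (n + 1)) (Fin (n + 1)) ℝ)

/-- The `ℂ[t]`-linear extension of the map with `φ ↦ tᵈ Q(φ)` for `φ` homogeneous of degree `d`. -/
def quantT {n : ℕ} (Q : Pol n ≃ₗ[ℂ] DiffOp n) (P : (Pol n)[X]) : (DiffOp n)[X] :=
  P.sum fun m φ => ∑ d ∈ Finset.range (φ.totalDegree + 1),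
    Polynomial.monomial (d + m) (Q (MvPolynomial.homogeneousComponent d φ))

/-- The star product `Q_t⁻¹ (Q_t(Φ) Q_t(Ψ))` on `(Pol n)[t]`. -/
def star {n : ℕ} (Q : Pol n ≃ₗ[ℂ] DiffOp n) (Φ Ψ : (Pol n)[X]) : (Pol n)[X] :=
  Function.invFun (quantT Q) (quantT Q Φ * quantT Q Ψ)

theorem coeff_euler {n : ℕ} (p : Pol n) (b : Fin n →₀ ℕ) :
    (euler n p).coeff b = (b.degree : ℂ) • p.coeff b := by
  classical
  induction p using MvPolynomial.induction_on' with
  | add p q hp hq => rw [map_add, MvPolynomial.coeff_add, hp, hq, MvPolynomial.coeff_add, smul_add]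
  | monomial a f =>
    have h : euler n (MvPolynomial.monomial a f) = (a.degree : ℂ) • MvPolynomial.monomial a f := by
      have h1 : euler n (MvPolynomial.monomial a f) =
          ∑ i, MvPolynomial.X i * MvPolynomial.pderiv i (MvPolynomial.monomial a f) := by
        simp [euler, dXi]
      rw [h1, (MvPolynomial.isHomogeneous_monomial f rfl).sum_X_mul_pderiv, Nat.cast_smul_eq_nsmul]
    rw [h, MvPolynomial.coeff_smul, MvPolynomial.coeff_monomial]
    split_ifs with hab
    · rw [hab]
    · simp

/-- The operator `2E + j + n + 1`. -/
def den (n j : ℕ) : Module.End ℂ (Pol n) :=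
  (2 : ℂ) • euler n + ((j : ℂ) + n + 1) • (1 : Module.End ℂ (Pol n))

theorem coeff_den {n : ℕ} (j : ℕ) (p : Pol n) (b : Fin n →₀ ℕ) :
    (den n j p).coeff b = (2 * (b.degree : ℂ) + (j + n + 1)) • p.coeff b := by
  simp [den, coeff_euler, add_smul, mul_smul]

/-- The operator `2E + j + n + 1` is invertible. -/
theorem isUnit_den (n j : ℕ) : IsUnit (den n j) := by
  have hne : ∀ b : Fin n →₀ ℕ, (2 * (b.degree : ℂ) + (j + n + 1)) ≠ 0 := fun b => by
    have : ((2 * b.degree + (j + n + 1) : ℕ) : ℂ) ≠ 0 := Nat.cast_ne_zero.2 (by omega)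
    exact_mod_cast this
  let inv : Module.End ℂ (Pol n) :=
    onCoeff fun b => (2 * (b.degree : ℂ) + (j + n + 1))⁻¹ • (1 : Module.End ℂ (Smooth n))
  refine ⟨⟨den n j, inv, ?_, ?_⟩, rfl⟩
  · refine LinearMap.ext fun p => MvPolynomial.ext _ _ fun b => ?_
    simp [inv, coeff_den, coeff_onCoeff, smul_smul, mul_inv_cancel₀ (hne b)]
  · refine LinearMap.ext fun p => MvPolynomial.ext _ _ fun b => ?_
    simp [inv, coeff_den, coeff_onCoeff, smul_smul, mul_inv_cancel₀ (hne b)]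

/-- The operator `g_{λ,d} = (1/d!) ∏_{j<d} (-E - j - λ(n+1)) / (2E + j + n + 1)`; all the factors
commute with each other. -/
def gCoeff (n : ℕ) (lam : ℂ) (d : ℕ) : Module.End ℂ (Pol n) :=
  ((d.factorial : ℂ)⁻¹) • ((List.range d).map fun j : ℕ =>
    (-euler n - ((j : ℂ) + lam * (n + 1)) • (1 : Module.End ℂ (Pol n))) *
      (↑(isUnit_den n j).unit⁻¹ : Module.End ℂ (Pol n))).prod

/-- `g_λ = 1 + Σ_{d ≥ 1} g_{λ,d} Dᵈ tᵈ`. The sum may be cut at the fibre degree of the argument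
since `D` lowers that degree. -/
def gOp {n : ℕ} (lam : ℂ) (φ : Pol n) : (Pol n)[X] :=
  Polynomial.C φ + ∑ d ∈ Finset.Icc 1 φ.totalDegree,
    Polynomial.monomial d (gCoeff n lam d ((opD n ^ d) φ))

/-- A polynomial in `ξ` with constant coefficients, as an element of `Pol n`. -/
def fibrePoly {n : ℕ} (ψ : MvPolynomial (Fin n) ℂ) : Pol n :=
  MvPolynomial.map (algebraMap ℂ (Smooth n)) ψ

end ProjStar

end

open scoped ContDiff Polynomial

noncomputable section

namespace ProjStar

open MvPolynomial (X C coeff monomial)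

variable {n : ℕ}

/-! ### Calculus of smooth functions -/

/-! Normal ordering `fullSymbolMap`, `Σ fₐ ξᵃ ↦ Σ fₐ ∂ᵃ`, identifies symbols with differential
operators, and every construction is transported to full symbols. There the commutator with the Lie
derivative of `x` becomes the Hamiltonian action `act x` plus the defect `Σ x₀ⱼ (E + λ(n+1)) ∂/∂ξⱼ`
(`lieDensity_commutator`), which only the non-affine (quadratic) fields produce. The operator `D`
has a defect of the same kind: `[D, act x] = Σ x₀ⱼ (2E + n + 1) ∂/∂ξⱼ` (`opD_act`). In `Σ g_d Dᵈ`
the two defects cancel order by order exactly when the `g_d` obey the recursion `gScalar_succ`,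
whose solution is the stated product. So `g_λ` at `t = 1` intertwines the two actions (`gMap_act`).
It is unipotent for the degree filtration, hence invertible, and normal ordering after its inverse
is an equivariant quantization.

For uniqueness, two quantizations differ by an operator `T` on symbols that commutes with the
action. A Casimir element acts by `-2d(d+n)` in degree `d`, with distinct values for distinct `d`,
so `T` preserves degree. Since `T` is also the identity modulo lower degree, `T = 1`
(`eq_projQuant`).

For the star product, `tᵐ` compensates the degree lost under `Dᵐ`, so `Q_t(g_λ p)` is the graded
normal ordering of `p` (`coeff_quantT_gOp`). Both `φ(u)` and `ψ(ξ)` are killed by `D`, so they are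
quantized by normal ordering, and the composition of `φ` with `ψ(∂)` is already normally ordered
with full symbol `φψ`. -/

theorem pd_mul (i : Fin n) (f g : Smooth n) : pd i (f * g) = pd i f * g + f * pd i g :=
  Smooth.ext fun u => by
    change fderiv ℝ (fun v => f v * g v) u (Pi.single i 1) =
      fderiv ℝ (fun v => f v) u (Pi.single i 1) * g u +
        f u * fderiv ℝ (fun v => g v) u (Pi.single i 1)
    rw [fderiv_fun_mul (f.differentiableAt u) (g.differentiableAt u)]
    simp only [add_apply, smul_apply, smul_eq_mul]
    ring

theorem pd_one (i : Fin n) : pd i (1 : Smooth n) = 0 := by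
  have h := pd_mul i (1 : Smooth n) 1
  simpa using h

theorem pd_coord (i j : Fin n) : pd i (coord j) = if i = j then 1 else 0 :=
  Smooth.ext fun u => by
    change fderiv ℝ (fun v : Fin n → ℝ => ((v j : ℝ) : ℂ)) u (Pi.single i 1) = _
    have h : HasFDerivAt (fun v : Fin n → ℝ => ((v j : ℝ) : ℂ))
        (Complex.ofRealCLM.comp (ContinuousLinearMap.proj j)) u :=
      (Complex.ofRealCLM.comp (ContinuousLinearMap.proj (R := ℝ) (φ := fun _ : Fin n => ℝ)
        j)).hasFDerivAt
    rw [h.fderiv]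
    by_cases hij : i = j
    · subst hij
      simp only [ContinuousLinearMap.comp_apply, ContinuousLinearMap.proj_apply, Pi.single_eq_same,
        if_true]
      exact Complex.ofReal_one
    · simp only [ContinuousLinearMap.comp_apply, ContinuousLinearMap.proj_apply, if_neg hij,
        Pi.single_eq_of_ne (Ne.symm hij)]
      exact Complex.ofReal_zero

theorem pd_pd_comm (i j : Fin n) (f : Smooth n) : pd i (pd j f) = pd j (pd i f) :=
  Smooth.ext fun u => by
    have hd : DifferentiableAt ℝ (fderiv ℝ fun v => f v) u :=
      (ContDiff.fderiv_right (m := ∞) f.contDiff (by simp)).differentiable (by simp) u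
    have key : ∀ a b : Fin n, pd a (pd b f) u =
        fderiv ℝ (fderiv ℝ fun v => f v) u (Pi.single a 1) (Pi.single b 1) := fun a b => by
      change fderiv ℝ (fun v => fderiv ℝ (fun w => f w) v (Pi.single b 1)) u (Pi.single a 1) = _
      rw [fderiv_clm_apply hd (differentiableAt_const _)]
      simp
    rw [key, key]
    exact (f.contDiff.contDiffAt.isSymmSndFDerivAt
      (by simpa using WithTop.coe_le_coe.2 (le_top : (2 : ℕ∞) ≤ ⊤))).eq _ _

theorem pd_commute (i j : Fin n) : Commute (pd i) (pd j) :=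
  LinearMap.ext fun f => pd_pd_comm i j f

theorem pd_mul_mulOp (i : Fin n) (f : Smooth n) :
    pd i * mulOp f = mulOp f * pd i + mulOp (pd i f) :=
  LinearMap.ext fun g => by
    change pd i (f * g) = f * pd i g + pd i f * g
    rw [pd_mul, add_comm]

theorem mulOp_mul (f g : Smooth n) : mulOp (f * g) = mulOp f * mulOp g :=
  LinearMap.ext fun h => mul_assoc f g h

theorem mulOp_add (f g : Smooth n) : mulOp (f + g) = mulOp f + mulOp g :=
  LinearMap.ext fun h => add_mul f g h

theorem mulOp_smul (c : ℂ) (f : Smooth n) : mulOp (c • f) = c • mulOp f :=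
  LinearMap.ext fun h => smul_mul_assoc c f h

theorem mulOp_zero : mulOp (0 : Smooth n) = 0 :=
  LinearMap.ext fun h => zero_mul h

theorem mulOp_one : mulOp (1 : Smooth n) = 1 :=
  LinearMap.ext fun h => one_mul h

/-! ### Calculus of fibrewise polynomial functions -/

theorem coeff_dU (i : Fin n) (p : Pol n) (b : Fin n →₀ ℕ) :
    coeff b (dU i p) = pd i (coeff b p) := coeff_onCoeff _ _ _

theorem dU_monomial (i : Fin n) (a : Fin n →₀ ℕ) (f : Smooth n) :
    dU i (monomial a f) = monomial a (pd i f) := by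
  classical
  ext1 b
  rw [coeff_dU, MvPolynomial.coeff_monomial, MvPolynomial.coeff_monomial]
  split_ifs <;> simp

theorem dU_C (i : Fin n) (f : Smooth n) : dU i (C f) = C (pd i f) := dU_monomial i 0 f

theorem dU_one (i : Fin n) : dU i (1 : Pol n) = 0 := by
  rw [← MvPolynomial.C_1, dU_C, pd_one, MvPolynomial.C_0]

theorem dU_X (i j : Fin n) : dU i (X j : Pol n) = 0 := by
  rw [MvPolynomial.X, dU_monomial, pd_one, MvPolynomial.monomial_zero]

theorem dU_mul (i : Fin n) (p q : Pol n) : dU i (p * q) = dU i p * q + p * dU i q := by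
  induction p using MvPolynomial.induction_on' with
  | add p p' hp hp' => simp only [add_mul, map_add, hp, hp']; ring
  | monomial a f =>
    induction q using MvPolynomial.induction_on' with
    | add q q' hq hq' => simp only [mul_add, map_add, hq, hq']; ring
    | monomial b g =>
      simp only [MvPolynomial.monomial_mul, dU_monomial, pd_mul, map_add]

theorem coeff_dXi (i : Fin n) (p : Pol n) (b : Fin n →₀ ℕ) :
    coeff b (dXi i p) = coeff (b + Finsupp.single i 1) p * (b i + 1) :=
  MvPolynomial.coeff_pderiv ..

theorem dXi_mul (i : Fin n) (p q : Pol n) : dXi i (p * q) = dXi i p * q + p * dXi i q := by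
  change MvPolynomial.pderiv i (p * q) = MvPolynomial.pderiv i p * q + p * MvPolynomial.pderiv i q
  rw [Derivation.leibniz, smul_eq_mul, smul_eq_mul]
  ring

theorem dXi_C (i : Fin n) (f : Smooth n) : dXi i (C f) = 0 := MvPolynomial.pderiv_C

theorem dXi_X (i j : Fin n) : dXi i (X j : Pol n) = if i = j then 1 else 0 := by
  classical
  change MvPolynomial.pderiv i (X j) = _
  rw [MvPolynomial.pderiv_X, Pi.single_apply]
  simp [eq_comm]

theorem dU_dU_comm (i j : Fin n) (p : Pol n) : dU i (dU j p) = dU j (dU i p) := by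
  ext1 b
  simp only [coeff_dU, pd_pd_comm i j]

theorem dXi_dU_comm (i j : Fin n) (p : Pol n) : dXi i (dU j p) = dU j (dXi i p) := by
  induction p using MvPolynomial.induction_on with
  | C f => simp only [dU_C, dXi_C, map_zero]
  | add p q hp hq => simp only [map_add, hp, hq]
  | mul_X p k hp =>
    simp only [dU_mul, dXi_mul, dU_X, dXi_X, map_add, hp, mul_zero, add_zero]
    split_ifs <;> simp [dU_one]

theorem dXi_dXi_comm (i j : Fin n) (p : Pol n) : dXi i (dXi j p) = dXi j (dXi i p) := by
  induction p using MvPolynomial.induction_on with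
  | C f => simp only [dXi_C, map_zero]
  | add p q hp hq => simp only [map_add, hp, hq]
  | mul_X p k hp =>
    simp only [dXi_mul, dXi_X, map_add, hp]
    split_ifs <;> simp [dXi, add_comm, add_left_comm]

/-- The base coordinate `uᵢ` as a function on the cotangent bundle. -/
abbrev uC (i : Fin n) : Pol n := C (coord i)

theorem dU_uC (i j : Fin n) : dU i (uC j) = if i = j then 1 else 0 := by
  rw [dU_C, pd_coord]
  split_ifs <;> simp

theorem dU_uC_mul (i j : Fin n) (q : Pol n) :
    dU i (uC j * q) = (if i = j then q else 0) + uC j * dU i q := by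
  rw [dU_mul, dU_uC]
  split_ifs <;> simp

theorem dXi_uC_mul (i j : Fin n) (q : Pol n) : dXi i (uC j * q) = uC j * dXi i q := by
  rw [dXi_mul, dXi_C, zero_mul, zero_add]

theorem dU_X_mul (i j : Fin n) (q : Pol n) : dU i (X j * q) = X j * dU i q := by
  rw [dU_mul, dU_X, zero_mul, zero_add]

theorem dXi_X_mul (i j : Fin n) (q : Pol n) :
    dXi i (X j * q) = (if i = j then q else 0) + X j * dXi i q := by
  rw [dXi_mul, dXi_X]
  split_ifs <;> simp

/-! ### The Weyl algebra relations for `D`, `E`, the base Euler field and the pairing `u · ξ` -/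

/-- The Euler vector field `Σ uᵢ ∂/∂uᵢ` of the base. -/
def baseEuler (n : ℕ) : Module.End ℂ (Pol n) := ∑ i, LinearMap.mulLeft ℂ (uC i) * dU i

/-- The tautological pairing `Σ uᵢ ξᵢ`. -/
def pairing (n : ℕ) : Pol n := ∑ i, uC i * X i

theorem opD_apply (q : Pol n) : opD n q = ∑ i, dU i (dXi i q) := by
  simp [opD]

theorem euler_apply (q : Pol n) : euler n q = ∑ i, X i * dXi i q := by
  simp [euler]

theorem baseEuler_apply (q : Pol n) : baseEuler n q = ∑ i, uC i * dU i q := by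
  simp [baseEuler]

theorem opD_uC_mul (j : Fin n) (q : Pol n) : opD n (uC j * q) = uC j * opD n q + dXi j q := by
  simp only [opD_apply, dXi_uC_mul, dU_uC_mul, Finset.sum_add_distrib, Finset.mul_sum,
    Finset.sum_ite_eq', Finset.mem_univ, if_true]
  ring

theorem opD_X_mul (j : Fin n) (q : Pol n) : opD n (X j * q) = X j * opD n q + dU j q := by
  simp only [opD_apply, dXi_X_mul, map_add, dU_X_mul, Finset.sum_add_distrib, Finset.mul_sum,
    apply_ite (dU _), map_zero, Finset.sum_ite_eq', Finset.mem_univ, if_true]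
  ring

theorem opD_dU (j : Fin n) (q : Pol n) : opD n (dU j q) = dU j (opD n q) := by
  simp only [opD_apply, map_sum, dXi_dU_comm, dU_dU_comm j]

theorem opD_dXi (j : Fin n) (q : Pol n) : opD n (dXi j q) = dXi j (opD n q) := by
  simp only [opD_apply, map_sum, dXi_dU_comm, dXi_dXi_comm j]

theorem euler_uC_mul (j : Fin n) (q : Pol n) : euler n (uC j * q) = uC j * euler n q := by
  simp only [euler_apply, dXi_uC_mul, Finset.mul_sum]
  exact Finset.sum_congr rfl fun i _ => by ring

theorem euler_X_mul (j : Fin n) (q : Pol n) : euler n (X j * q) = X j * euler n q + X j * q := by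
  simp only [euler_apply, dXi_X_mul, mul_add, Finset.sum_add_distrib, Finset.mul_sum, mul_ite,
    mul_zero, Finset.sum_ite_eq', Finset.mem_univ, if_true]
  rw [add_comm]
  congr 1
  exact Finset.sum_congr rfl fun i _ => by ring

theorem euler_dU (j : Fin n) (q : Pol n) : euler n (dU j q) = dU j (euler n q) := by
  simp only [euler_apply, map_sum, dU_X_mul, dXi_dU_comm]

theorem dXi_euler (j : Fin n) (q : Pol n) : dXi j (euler n q) = euler n (dXi j q) + dXi j q := by
  simp only [euler_apply, map_sum, dXi_X_mul, Finset.sum_add_distrib, Finset.sum_ite_eq,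
    Finset.mem_univ, if_true, dXi_dXi_comm j]
  ring

theorem opD_euler (q : Pol n) : opD n (euler n q) = euler n (opD n q) + opD n q := by
  rw [opD_apply, opD_apply, map_sum, ← Finset.sum_add_distrib]
  simp only [dXi_euler, map_add, euler_dU]

theorem dU_baseEuler (j : Fin n) (q : Pol n) :
    dU j (baseEuler n q) = baseEuler n (dU j q) + dU j q := by
  simp only [baseEuler_apply, map_sum, dU_uC_mul, Finset.sum_add_distrib, Finset.sum_ite_eq,
    Finset.mem_univ, if_true, dU_dU_comm j]
  ring

theorem dXi_baseEuler (j : Fin n) (q : Pol n) :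
    dXi j (baseEuler n q) = baseEuler n (dXi j q) := by
  simp only [baseEuler_apply, map_sum, dXi_uC_mul, dXi_dU_comm]

theorem opD_baseEuler (q : Pol n) :
    opD n (baseEuler n q) = baseEuler n (opD n q) + opD n q := by
  rw [opD_apply, opD_apply, map_sum, ← Finset.sum_add_distrib]
  simp only [dXi_baseEuler, dU_baseEuler]

theorem euler_baseEuler (q : Pol n) : euler n (baseEuler n q) = baseEuler n (euler n q) := by
  simp only [baseEuler_apply, map_sum, euler_uC_mul, euler_dU]

theorem pairing_mul (q : Pol n) : pairing n * q = ∑ i, uC i * (X i * q) := by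
  simp only [pairing, Finset.sum_mul, mul_assoc]

/-- `D` and multiplication by `u · ξ` span an `sl₂` together with the Cartan element `baseEuler + E
+ n`. -/
theorem opD_pairing_mul (q : Pol n) :
    opD n (pairing n * q) = pairing n * opD n q + baseEuler n q + euler n q + n * q := by
  simp only [pairing_mul, map_sum, opD_uC_mul, opD_X_mul, mul_add, dXi_X_mul, if_true,
    Finset.sum_add_distrib, baseEuler_apply, euler_apply, Finset.sum_const, Finset.card_univ,
    Fintype.card_fin, nsmul_eq_mul]
  ring

theorem euler_pairing_mul (q : Pol n) :
    euler n (pairing n * q) = pairing n * euler n q + pairing n * q := by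
  simp only [pairing_mul, map_sum, euler_uC_mul, euler_X_mul, mul_add, Finset.sum_add_distrib]

theorem dU_pairing_mul (j : Fin n) (q : Pol n) :
    dU j (pairing n * q) = X j * q + pairing n * dU j q := by
  simp only [pairing_mul, map_sum, dU_uC_mul, dU_X_mul, Finset.sum_add_distrib, Finset.sum_ite_eq,
    Finset.mem_univ, if_true]

/-! ### The action of matrices on symbols -/

theorem vf_add (x y : Matrix (Fin (n + 1)) (Fin (n + 1)) ℝ) (i : Fin n) :
    vf (x + y) i = vf x i + vf y i := by
  simp only [vf, linComp, Matrix.add_apply, Complex.ofReal_add, add_smul, Finset.sum_add_distrib]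
  ring

theorem linComp_single (a b k : Fin (n + 1)) (r : ℝ) :
    linComp (Matrix.single a b r) k = if k = a then (r : ℂ) • homCoord n b else 0 := by
  classical
  simp only [linComp, Matrix.single_apply]
  split_ifs with h
  · subst h
    simp [ite_smul, Finset.sum_ite_eq, apply_ite]
  · simp [Ne.symm h]

/-- Additivity in `x` reduces identities to matrix units. Using `homCoord n b` treats the columns `b
= 0` and `b > 0` together; row `0` with `b > 0` gives the quadratic fields. -/
theorem vf_single_succ (k : Fin n) (b : Fin (n + 1)) (r : ℝ) (i : Fin n) :
    vf (Matrix.single k.succ b r) i = if i = k then (r : ℂ) • homCoord n b else 0 := by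
  simp [vf, linComp_single, (Fin.succ_ne_zero k).symm]

theorem vf_single_zero (b : Fin (n + 1)) (r : ℝ) (i : Fin n) :
    vf (Matrix.single 0 b r) i = -(r : ℂ) • (coord i * homCoord n b) := by
  simp [vf, linComp_single]

/-- Scalars fix every point of projective space. Identities may therefore be checked on all of
`gl(n+1)`, where matrix units are available. -/
theorem vf_one (i : Fin n) : vf (1 : Matrix (Fin (n + 1)) (Fin (n + 1)) ℝ) i = 0 := by
  classical
  have h : ∀ k, linComp (1 : Matrix (Fin (n + 1)) (Fin (n + 1)) ℝ) k = homCoord n k := fun k => by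
    simp [linComp, Matrix.one_apply, apply_ite, ite_smul]
  simp [vf, h, homCoord]

theorem vf_smul (c : ℝ) (x : Matrix (Fin (n + 1)) (Fin (n + 1)) ℝ) (i : Fin n) :
    vf (c • x) i = (c : ℂ) • vf x i := by
  simp only [vf, linComp, Matrix.smul_apply, smul_eq_mul, Complex.ofReal_mul, mul_smul,
    ← Finset.smul_sum, smul_sub, mul_smul_comm]

theorem momentum_add (x y : Matrix (Fin (n + 1)) (Fin (n + 1)) ℝ) :
    (momentum (x + y) : Pol n) = momentum x + momentum y := by
  simp only [momentum, vf_add, map_add, add_mul, Finset.sum_add_distrib]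

/-- The Poisson bracket with the momentum function of `x`, as an operator. -/
def act (x : Matrix (Fin (n + 1)) (Fin (n + 1)) ℝ) : Module.End ℂ (Pol n) :=
  ∑ i, (LinearMap.mulLeft ℂ (C (vf x i)) * dU i - LinearMap.mulLeft ℂ (dU i (momentum x)) * dXi i)

theorem act_apply (x : Matrix (Fin (n + 1)) (Fin (n + 1)) ℝ) (q : Pol n) :
    act x q = ∑ i, (C (vf x i) * dU i q - dU i (momentum x) * dXi i q) := by
  simp [act]

theorem dXi_momentum (x : Matrix (Fin (n + 1)) (Fin (n + 1)) ℝ) (i : Fin n) :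
    dXi i (momentum x) = C (vf x i) := by
  simp [momentum, dXi_mul, dXi_C, dXi_X]

theorem dU_momentum (x : Matrix (Fin (n + 1)) (Fin (n + 1)) ℝ) (i : Fin n) :
    dU i (momentum x) = ∑ k, C (pd i (vf x k)) * X k := by
  simp [momentum, dU_mul, dU_C, dU_X]

theorem poisson_momentum (x : Matrix (Fin (n + 1)) (Fin (n + 1)) ℝ) (q : Pol n) :
    poisson (momentum x) q = act x q := by
  simp only [poisson, act_apply, dXi_momentum]

theorem act_add (x y : Matrix (Fin (n + 1)) (Fin (n + 1)) ℝ) :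
    (act (x + y) : Module.End ℂ (Pol n)) = act x + act y := by
  refine LinearMap.ext fun q => ?_
  simp only [LinearMap.add_apply, act_apply, ← Finset.sum_add_distrib, vf_add, momentum_add,
    map_add]
  exact Finset.sum_congr rfl fun i _ => by ring

theorem act_smul_one (c : ℝ) :
    (act (c • (1 : Matrix (Fin (n + 1)) (Fin (n + 1)) ℝ)) : Module.End ℂ (Pol n)) = 0 := by
  refine LinearMap.ext fun q => ?_
  simp [act_apply, momentum, vf_smul, vf_one]

theorem C_smul (c : ℂ) (f : Smooth n) : (C (c • f) : Pol n) = c • C f :=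
  (MvPolynomial.smul_monomial c).symm

theorem act_single_succ (k : Fin n) (b : Fin (n + 1)) (r : ℝ) (q : Pol n) :
    act (Matrix.single k.succ b r) q = (r : ℂ) • (C (homCoord n b) * dU k q -
      X k * ∑ i, C (pd i (homCoord n b)) * dXi i q) := by
  have h : ∀ i, dU i (momentum (Matrix.single k.succ b r)) =
      (r : ℂ) • (C (pd i (homCoord n b)) * X k) := fun i => by
    simp only [dU_momentum, vf_single_succ, apply_ite (pd i), map_smul, map_zero]
    rw [Finset.sum_eq_single k (by simp +contextual) (by simp), if_pos rfl, C_smul,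
      smul_mul_assoc]
  have h' : ∑ i, C (vf (Matrix.single k.succ b r) i) * dU i q =
      (r : ℂ) • (C (homCoord n b) * dU k q) := by
    rw [Finset.sum_eq_single k (by simp +contextual [vf_single_succ]) (by simp), vf_single_succ,
      if_pos rfl, C_smul, smul_mul_assoc]
  rw [act_apply, Finset.sum_sub_distrib, h', smul_sub, Finset.mul_sum, Finset.smul_sum]
  refine congrArg _ (Finset.sum_congr rfl fun i _ => ?_)
  rw [h, smul_mul_assoc, mul_comm (C _), mul_assoc]

/-- The momentum function is `-r h (u · ξ)` with `h = homCoord n b`. Leibniz applies: the bracket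
with `u · ξ` is `baseEuler - E`, and the bracket with `h` is `-Σ (∂h/∂uᵢ) ∂/∂ξᵢ`. -/
theorem act_single_zero (b : Fin (n + 1)) (r : ℝ) (q : Pol n) :
    act (Matrix.single 0 b r) q = -(r : ℂ) • (C (homCoord n b) * (baseEuler n q - euler n q) -
      pairing n * ∑ i, C (pd i (homCoord n b)) * dXi i q) := by
  have h : ∀ i, dU i (momentum (Matrix.single 0 b r)) =
      -(r : ℂ) • (C (homCoord n b) * X i + C (pd i (homCoord n b)) * pairing n) := fun i => by
    have h1 : momentum (Matrix.single 0 b r) = -(r : ℂ) • (C (homCoord n b) * pairing n) := by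
      simp only [momentum, vf_single_zero, pairing, Finset.mul_sum, Finset.smul_sum, C_smul,
        map_mul, smul_mul_assoc]
      exact Finset.sum_congr rfl fun k _ => by rw [mul_right_comm, mul_comm]
    have h2 := dU_pairing_mul i (1 : Pol n)
    rw [mul_one, dU_one, mul_one, mul_zero, add_zero] at h2
    rw [h1, map_smul, dU_mul, dU_C, h2, add_comm]
  simp only [act_apply, h, vf_single_zero, baseEuler_apply, euler_apply, ← Finset.sum_sub_distrib,
    Finset.mul_sum, Finset.smul_sum, C_smul, map_mul, smul_mul_assoc, ← smul_sub]
  exact Finset.sum_congr rfl fun i _ => by congr 1; ring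

theorem homCoord_zero : homCoord n 0 = 1 := rfl

theorem homCoord_succ (j : Fin n) : homCoord n j.succ = coord j := rfl

theorem sum_pd_homCoord_zero (q : Pol n) :
    ∑ i, C (pd i (homCoord n 0)) * dXi i q = 0 := by
  simp [homCoord_zero, pd_one]

theorem sum_pd_homCoord_succ (j : Fin n) (q : Pol n) :
    ∑ i, C (pd i (homCoord n j.succ)) * dXi i q = dXi j q := by
  simp [homCoord_succ, pd_coord, apply_ite]

/-- The Hamiltonian action of `uⱼ ∂ₖ` on symbols. -/
theorem act_single_succ_succ (k j : Fin n) (r : ℝ) (q : Pol n) :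
    act (Matrix.single k.succ j.succ r) q = (r : ℂ) • (uC j * dU k q - X k * dXi j q) := by
  rw [act_single_succ, sum_pd_homCoord_succ, homCoord_succ]

theorem act_single_succ_zero (k : Fin n) (r : ℝ) (q : Pol n) :
    act (Matrix.single k.succ 0 r) q = (r : ℂ) • dU k q := by
  rw [act_single_succ, sum_pd_homCoord_zero, homCoord_zero, map_one, one_mul, mul_zero, sub_zero]

theorem act_single_zero_zero (r : ℝ) (q : Pol n) :
    act (Matrix.single 0 0 r) q = -(r : ℂ) • (baseEuler n q - euler n q) := by
  rw [act_single_zero, sum_pd_homCoord_zero, homCoord_zero, map_one, one_mul, mul_zero, sub_zero]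

theorem act_single_zero_succ (j : Fin n) (r : ℝ) (q : Pol n) :
    act (Matrix.single 0 j.succ r) q =
      -(r : ℂ) • (uC j * (baseEuler n q - euler n q) - pairing n * dXi j q) := by
  rw [act_single_zero, sum_pd_homCoord_succ, homCoord_succ]

/-- The action preserves the fibre degree. -/
theorem act_euler (x : Matrix (Fin (n + 1)) (Fin (n + 1)) ℝ) (q : Pol n) :
    act x (euler n q) = euler n (act x q) := by
  induction x using Matrix.induction_on with
  | h_add x y hx hy => simp only [act_add, LinearMap.add_apply, hx, hy, map_add]
  | h_std_basis a b r =>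
    refine Fin.cases (Fin.cases ?_ (fun j => ?_) b) (fun k => Fin.cases ?_ (fun j => ?_) b) a
    · simp only [act_single_zero_zero, map_smul, map_sub, euler_baseEuler]
    · simp only [act_single_zero_succ, map_smul, map_sub, euler_uC_mul, euler_pairing_mul,
        euler_baseEuler, dXi_euler]
      congr 1; ring
    · simp only [act_single_succ_zero, map_smul, euler_dU]
    · simp only [act_single_succ_succ, map_smul, map_sub, euler_uC_mul, euler_X_mul, euler_dU,
        dXi_euler]
      congr 1; ring

/-- The defect of equivariance of `D`: the divergence `D` commutes with affine vector fields only. -/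
theorem opD_act (x : Matrix (Fin (n + 1)) (Fin (n + 1)) ℝ) (q : Pol n) :
    opD n (act x q) = act x (opD n q) +
      ∑ j : Fin n, (x 0 j.succ : ℂ) • (den n 0 (dXi j q)) := by
  classical
  induction x using Matrix.induction_on with
  | h_add x y hx hy =>
    simp only [act_add, LinearMap.add_apply, hx, hy, map_add, Matrix.add_apply,
      Complex.ofReal_add, add_smul, Finset.sum_add_distrib]
    abel
  | h_std_basis a b r =>
    refine Fin.cases (Fin.cases ?_ (fun j => ?_) b) (fun k => Fin.cases ?_ (fun j => ?_) b) a
    · simp only [act_single_zero_zero, map_smul, map_sub, opD_baseEuler, opD_euler,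
        Matrix.single_apply, (Fin.succ_ne_zero _).symm, and_false, if_false, Complex.ofReal_zero,
        zero_smul, Finset.sum_const_zero, add_zero]
      congr 1; ring
    · have h : ∑ i : Fin n, ((Matrix.single 0 j.succ r : Matrix (Fin (n + 1)) _ ℝ) 0 i.succ : ℂ) •
          den n 0 (dXi i q) = (r : ℂ) • den n 0 (dXi j q) := by
        rw [Finset.sum_eq_single j (fun i _ hi => by simp [hi.symm])
          (by simp)]
        simp
      have h' : den n 0 (dXi j q) = 2 * euler n (dXi j q) + (n + 1) * dXi j q := by
        have h2 : den n 0 (dXi j q) = (2 : ℂ) • euler n (dXi j q) + ((n : ℂ) + 1) • dXi j q := by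
          simp [den]
        rw [h2, two_smul, add_smul, one_smul, Nat.cast_smul_eq_nsmul, nsmul_eq_mul]
        ring
      rw [h, h']
      -- Moving `D` past `uⱼ` and past `u · ξ` leaves terms in `baseEuler` that cancel. What
      -- survives is `2E + n + 1`, the source of the denominators of `g_λ`.
      simp only [act_single_zero_succ, map_smul, map_sub, opD_uC_mul, opD_pairing_mul, opD_euler,
        opD_baseEuler, dXi_euler, dXi_baseEuler, opD_dXi]
      simp only [neg_smul, ← smul_neg, ← smul_add]
      congr 1; ring
    · simp [act_single_succ_zero, opD_dU]
    · simp only [act_single_succ_succ, map_smul, map_sub, opD_uC_mul, opD_X_mul, opD_dU, opD_dXi,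
        Matrix.single_apply, Fin.succ_ne_zero, false_and, if_false, Complex.ofReal_zero,
        zero_smul, Finset.sum_const_zero, add_zero, dXi_dU_comm]
      congr 1; ring

/-! ### The Casimir element on symbols. -/

theorem sum_uC_mul_baseEuler_dU (q : Pol n) :
    ∑ j, uC j * baseEuler n (dU j q) = baseEuler n (baseEuler n q) - baseEuler n q := by
  rw [baseEuler_apply (baseEuler n q)]
  simp only [dU_baseEuler, mul_add, Finset.sum_add_distrib, ← baseEuler_apply, add_sub_cancel_right]

theorem sum_X_mul_euler_dXi (q : Pol n) :
    ∑ j, X j * euler n (dXi j q) = euler n (euler n q) - euler n q := by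
  rw [euler_apply (euler n q)]
  simp only [dXi_euler, mul_add, Finset.sum_add_distrib, ← euler_apply, add_sub_cancel_right]

/-- The part of the Casimir that pairs the translations with the quadratic fields. -/
theorem sum_translation_inversion (q : Pol n) :
    ∑ i, dU i (uC i * (baseEuler n q - euler n q) - pairing n * dXi i q) =
      n * (baseEuler n q - euler n q) + baseEuler n (baseEuler n q - euler n q) -
        (euler n q + pairing n * opD n q) := by
  simp only [map_sub (dU _), dU_uC_mul, if_true, dU_pairing_mul, Finset.sum_sub_distrib,
    Finset.sum_add_distrib, Finset.sum_const, Finset.card_univ, Fintype.card_fin, nsmul_eq_mul,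
    ← Finset.mul_sum, ← opD_apply, ← euler_apply]
  rw [baseEuler_apply (baseEuler n q - euler n q)]
  simp only [map_sub]
  ring

/-- The part of the Casimir coming from the block `gl(n)` of linear fields. -/
theorem sum_linear_linear (q : Pol n) :
    ∑ k, ∑ j, (uC j * dU k (uC k * dU j q - X j * dXi k q) -
        X k * dXi j (uC k * dU j q - X j * dXi k q)) =
      baseEuler n (baseEuler n q) + (n - 1) * baseEuler n q - 2 * (pairing n * opD n q) +
        euler n (euler n q) + (n - 1) * euler n q := by
  have h : ∀ k j : Fin n, uC j * dU k (uC k * dU j q - X j * dXi k q) -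
        X k * dXi j (uC k * dU j q - X j * dXi k q) =
      uC j * dU j q + uC j * (uC k * dU k (dU j q)) - uC j * X j * dU k (dXi k q) -
        uC k * X k * dU j (dXi j q) + X k * dXi k q + X k * (X j * dXi j (dXi k q)) :=
    fun k j => by
      simp only [map_sub, dU_uC_mul, dXi_uC_mul, dU_X_mul, dXi_X_mul, if_true, dXi_dU_comm]
      ring
  simp only [h, Finset.sum_add_distrib, Finset.sum_sub_distrib, Finset.sum_const,
    Finset.card_univ, Fintype.card_fin, nsmul_eq_mul, ← Finset.mul_sum, ← Finset.sum_mul,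
    ← opD_apply, ← euler_apply, ← baseEuler_apply]
  rw [Finset.sum_comm]
  simp only [← Finset.mul_sum, ← baseEuler_apply, sum_uC_mul_baseEuler_dU, sum_X_mul_euler_dXi]
  change _ + _ - pairing n * _ - pairing n * _ + _ + _ = _
  ring

/-- A Casimir element of the projective Lie algebra acts on symbols of degree `d` by `-2d(d+n)`. -/
theorem casimir_act (q : Pol n) :
    2 * ∑ i : Fin n, act (Matrix.single i.succ 0 1) (act (Matrix.single 0 i.succ (-1)) q) -
      ∑ k : Fin n, ∑ j : Fin n,
        act (Matrix.single k.succ j.succ 1) (act (Matrix.single j.succ k.succ 1) q) -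
      act (Matrix.single 0 0 1) (act (Matrix.single 0 0 1) q) +
      (n + 1) * act (Matrix.single 0 0 1) q = -2 * (euler n (euler n q) + n * euler n q) := by
  -- The left side is minus `Σ E_ab E_ba`. The products `E_0i E_i0` have been reordered; as `act`
  -- reverses brackets and kills scalars, this costs the term in `(n+1) E_00`. All terms in
  -- `baseEuler` and in `(u · ξ) D` cancel.
  simp only [act_single_succ_zero, act_single_zero_succ, act_single_succ_succ,
    act_single_zero_zero, Complex.ofReal_one, Complex.ofReal_neg, neg_neg, one_smul, neg_smul]
  rw [sum_translation_inversion, sum_linear_linear]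
  simp only [map_neg, map_sub, euler_baseEuler]
  ring

/-! ### The full symbol calculus -/

/-- The extra factor sits at position `i` of an ordered product; commutativity of the factors
carries it to the right end. -/
theorem prod_ofFn_pow_add_single {M : Type*} [Monoid M] : ∀ {m : ℕ} (f : Fin m → M)
    (_ : ∀ i j, Commute (f i) (f j)) (a : Fin m → ℕ) (i : Fin m),
    (List.ofFn fun k => f k ^ (a k + if k = i then 1 else 0)).prod =
      (List.ofFn fun k => f k ^ a k).prod * f i
  | 0, _, _, _, i => i.elim0
  | m + 1, f, hf, a, i => by
    rw [List.ofFn_succ, List.prod_cons, List.ofFn_succ, List.prod_cons]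
    refine Fin.cases ?_ (fun i => ?_) i
    · have hc : Commute (f 0) (List.ofFn fun k : Fin m => f k.succ ^ a k.succ).prod := by
        refine Commute.list_prod_right _ _ fun x hx => ?_
        obtain ⟨k, rfl⟩ := (List.mem_ofFn' _ _).1 hx
        exact (hf 0 k.succ).pow_right _
      simp only [Fin.succ_ne_zero, if_true, if_false, add_zero, pow_succ, mul_assoc, hc.eq]
    · have h := prod_ofFn_pow_add_single (fun k : Fin m => f k.succ) (fun k l => hf _ _)
        (fun k => a k.succ) i
      simp only [(Fin.succ_ne_zero i).symm, if_false, add_zero, Fin.succ_inj, h, mul_assoc]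

theorem pdPow_add_single (a : Fin n →₀ ℕ) (i : Fin n) :
    pdPow (a + Finsupp.single i 1) = pdPow a * pd i := by
  classical
  rw [pdPow, pdPow, ← prod_ofFn_pow_add_single _ pd_commute]
  simp only [Finsupp.add_apply, Finsupp.single_apply, eq_comm]

theorem pdPow_zero : pdPow (0 : Fin n →₀ ℕ) = 1 := by
  simp [pdPow, List.prod_eq_one]

/-- `ofFullSymbol` as a linear map. -/
def fullSymbolMap (n : ℕ) : Pol n →ₗ[ℂ] Module.End ℂ (Smooth n) where
  toFun := ofFullSymbol
  map_add' p q := by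
    exact Finsupp.sum_add_index' (h := fun a f => mulOp f * pdPow a)
      (fun a => by rw [mulOp_zero, zero_mul]) fun a f g => by rw [mulOp_add, add_mul]
  map_smul' c p := by
    have h : ofFullSymbol (c • p) = ∑ a ∈ p.support, mulOp (coeff a (c • p)) * pdPow a := by
      refine Finset.sum_subset MvPolynomial.support_smul fun a _ ha => ?_
      rw [MvPolynomial.notMem_support_iff.1 ha, mulOp_zero, zero_mul]
    rw [h, ofFullSymbol, RingHom.id_apply, Finset.smul_sum]
    simp only [MvPolynomial.coeff_smul, mulOp_smul, smul_mul_assoc]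

theorem fullSymbolMap_apply (p : Pol n) : fullSymbolMap n p = ofFullSymbol p := rfl

theorem fullSymbolMap_monomial (a : Fin n →₀ ℕ) (f : Smooth n) :
    fullSymbolMap n (monomial a f) = mulOp f * pdPow a :=
  Finsupp.sum_single_index (h := fun a f => mulOp f * pdPow a) (by rw [mulOp_zero, zero_mul])

theorem fullSymbolMap_C (f : Smooth n) : fullSymbolMap n (C f) = mulOp f :=
  (fullSymbolMap_monomial 0 f).trans (by rw [pdPow_zero, mul_one])

theorem fullSymbolMap_C_mul (f : Smooth n) (p : Pol n) :
    fullSymbolMap n (C f * p) = mulOp f * fullSymbolMap n p := by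
  induction p using MvPolynomial.induction_on' with
  | add p q hp hq => simp only [mul_add, map_add, hp, hq]
  | monomial a g =>
    rw [MvPolynomial.C_mul_monomial, fullSymbolMap_monomial, fullSymbolMap_monomial, mulOp_mul,
      mul_assoc]

theorem fullSymbolMap_X_mul (i : Fin n) (p : Pol n) :
    fullSymbolMap n (X i * p) = fullSymbolMap n p * pd i := by
  induction p using MvPolynomial.induction_on' with
  | add p q hp hq => simp only [mul_add, add_mul, map_add, hp, hq]
  | monomial a g =>
    rw [mul_comm, MvPolynomial.X, MvPolynomial.monomial_mul, mul_one, fullSymbolMap_monomial,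
      fullSymbolMap_monomial, pdPow_add_single, mul_assoc]

theorem pd_mul_fullSymbolMap (i : Fin n) (p : Pol n) :
    pd i * fullSymbolMap n p = fullSymbolMap n (X i * p + dU i p) := by
  induction p using MvPolynomial.induction_on with
  | C f => rw [map_add, fullSymbolMap_X_mul, dU_C, fullSymbolMap_C, fullSymbolMap_C, pd_mul_mulOp]
  | add p q hp hq => simp only [mul_add, map_add, hp, hq]; abel
  | mul_X p k hp =>
    rw [mul_comm p, fullSymbolMap_X_mul, ← mul_assoc, hp, ← fullSymbolMap_X_mul, dU_X_mul]
    congr 1; ring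

/-- This is `[∂ₖ, uᵢ] = δᵢₖ` propagated through `∂ᵃ`. Coordinates suffice because the projective
fields are polynomial in `u`. -/
theorem fullSymbolMap_mul_coord (i : Fin n) (p : Pol n) :
    fullSymbolMap n p * mulOp (coord i) = fullSymbolMap n (uC i * p + dXi i p) := by
  induction p using MvPolynomial.induction_on with
  | C f => rw [dXi_C, add_zero, fullSymbolMap_C_mul, fullSymbolMap_C, ← mulOp_mul, ← mulOp_mul,
      mul_comm]
  | add p q hp hq => simp only [mul_add, add_mul, map_add, hp, hq]; abel
  | mul_X p k hp =>
    rw [mul_comm p, fullSymbolMap_X_mul, mul_assoc, pd_mul_mulOp, mul_add, ← mul_assoc, hp,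
      ← fullSymbolMap_X_mul, dXi_X_mul, pd_coord]
    have h : fullSymbolMap n p * mulOp (if k = i then 1 else 0) =
        fullSymbolMap n (if i = k then p else 0) := by
      by_cases hik : i = k
      · rw [if_pos hik, if_pos hik.symm, mulOp_one, mul_one]
      · rw [if_neg hik, if_neg (Ne.symm hik), mulOp_zero, mul_zero, map_zero]
    rw [h, ← map_add]
    congr 1; ring

/-- Vanishing of the coefficients of fibre degree at least `d`. -/
def DegLT (d : ℕ) (p : Pol n) : Prop := ∀ a : Fin n →₀ ℕ, d ≤ a.degree → coeff a p = 0

theorem degLT_zero {p : Pol n} (h : DegLT 0 p) : p = 0 :=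
  MvPolynomial.ext _ _ fun a => h a (Nat.zero_le _)

theorem degLT_totalDegree (p : Pol n) : DegLT (p.totalDegree + 1) p := fun a ha => by
  refine MvPolynomial.coeff_eq_zero_of_totalDegree_lt ?_
  exact Nat.lt_of_succ_le ha

theorem DegLT.mono {d e : ℕ} {p : Pol n} (h : DegLT d p) (hde : d ≤ e) : DegLT e p :=
  fun a ha => h a (hde.trans ha)

theorem DegLT.add {d : ℕ} {p q : Pol n} (hp : DegLT d p) (hq : DegLT d q) : DegLT d (p + q) :=
  fun a ha => by rw [MvPolynomial.coeff_add, hp a ha, hq a ha, add_zero]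

theorem DegLT.sub {d : ℕ} {p q : Pol n} (hp : DegLT d p) (hq : DegLT d q) : DegLT d (p - q) :=
  fun a ha => by rw [MvPolynomial.coeff_sub, hp a ha, hq a ha, sub_zero]

theorem DegLT.sum {ι : Type*} {s : Finset ι} {d : ℕ} {p : ι → Pol n}
    (h : ∀ i ∈ s, DegLT d (p i)) : DegLT d (∑ i ∈ s, p i) := fun a ha => by
  rw [MvPolynomial.coeff_sum]
  exact Finset.sum_eq_zero fun i hi => h i hi a ha

theorem DegLT.map_dXi {d : ℕ} {p : Pol n} (h : DegLT (d + 1) p) (i : Fin n) :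
    DegLT d (dXi i p) := fun a ha => by
  rw [coeff_dXi, h _ (by simpa using ha), zero_mul]

theorem DegLT.map_dU {d : ℕ} {p : Pol n} (h : DegLT d p) (i : Fin n) : DegLT d (dU i p) :=
  fun a ha => by rw [coeff_dU, h a ha, map_zero]

theorem DegLT.map_opD {d : ℕ} {p : Pol n} (h : DegLT (d + 1) p) : DegLT d (opD n p) := by
  rw [opD_apply]
  exact DegLT.sum fun i _ => (h.map_dXi i).map_dU i

/-- The commutator with `uᵢ` has full symbol `∂p/∂ξᵢ`, so the kernel is stable under `∂/∂ξᵢ` and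
induction on the degree leaves only symbols without `ξ`. Those are multiplication operators,
detected on the function `1`. -/
theorem eq_zero_of_fullSymbolMap_eq_zero (d : ℕ) : ∀ p : Pol n, DegLT d p →
    fullSymbolMap n p = 0 → p = 0 := by
  induction d with
  | zero => exact fun p hp _ => degLT_zero hp
  | succ d ih =>
    intro p hp h
    have hd : ∀ i, dXi i p = 0 := fun i => by
      refine ih _ (hp.map_dXi i) ?_
      have h1 := fullSymbolMap_mul_coord i p
      rwa [map_add, fullSymbolMap_C_mul, h, zero_mul, mul_zero, zero_add, eq_comm] at h1
    have he : euler n p = 0 := by simp [euler_apply, hd]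
    have hC : p = C (coeff 0 p) := by
      classical
      refine MvPolynomial.ext _ _ fun b => ?_
      rw [MvPolynomial.coeff_C]
      split_ifs with hb
      · rw [hb]
      · have h2 := coeff_euler p b
        rw [he, MvPolynomial.coeff_zero, eq_comm, smul_eq_zero] at h2
        refine h2.resolve_left fun h3 => hb ?_
        exact ((Finsupp.degree_eq_zero_iff b).1 (Nat.cast_eq_zero.1 h3)).symm
    rw [hC, fullSymbolMap_C] at h
    have h0 : coeff 0 p = 0 := by
      have := LinearMap.congr_fun h 1
      simpa [mulOp] using this
    rw [hC, h0, map_zero]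

theorem fullSymbolMap_injective : Function.Injective (fullSymbolMap n) :=
  (injective_iff_map_eq_zero _).2 fun p =>
    eq_zero_of_fullSymbolMap_eq_zero _ p (degLT_totalDegree p)

/-! ### Every differential operator has a full symbol. -/

theorem mulOp_mem (f : Smooth n) : mulOp f ∈ DiffOp n :=
  Algebra.subset_adjoin (Or.inl ⟨f, rfl⟩)

theorem pd_mem (i : Fin n) : pd i ∈ DiffOp n :=
  Algebra.subset_adjoin (Or.inr ⟨i, rfl⟩)

theorem fullSymbolMap_mem (p : Pol n) : fullSymbolMap n p ∈ DiffOp n := by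
  induction p using MvPolynomial.induction_on with
  | C f => rw [fullSymbolMap_C]; exact mulOp_mem f
  | add p q hp hq => rw [map_add]; exact add_mem hp hq
  | mul_X p k hp => rw [mul_comm, fullSymbolMap_X_mul]; exact mul_mem hp (pd_mem k)

/-- Stability of the normally ordered operators under left multiplication need only be checked on
generators, which avoids a general composition formula. The case `p = 1` gives surjectivity. -/
theorem exists_mul_fullSymbolMap {T : Module.End ℂ (Smooth n)} (hT : T ∈ DiffOp n) :
    ∀ p : Pol n, ∃ q : Pol n, fullSymbolMap n q = T * fullSymbolMap n p := by
  induction hT using Algebra.adjoin_induction with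
  | mem T hT =>
    rintro p
    rcases hT with ⟨f, rfl⟩ | ⟨i, rfl⟩
    · exact ⟨_, fullSymbolMap_C_mul f p⟩
    · exact ⟨_, (pd_mul_fullSymbolMap i p).symm⟩
  | algebraMap c =>
    exact fun p => ⟨c • p, by rw [map_smul, Algebra.algebraMap_eq_smul_one, smul_mul_assoc,
      one_mul]⟩
  | add S T _ _ hS hT =>
    intro p
    obtain ⟨q, hq⟩ := hS p
    obtain ⟨r, hr⟩ := hT p
    exact ⟨q + r, by rw [map_add, hq, hr, add_mul]⟩
  | mul S T _ _ hS hT =>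
    intro p
    obtain ⟨q, hq⟩ := hT p
    obtain ⟨r, hr⟩ := hS q
    exact ⟨r, by rw [hr, hq, mul_assoc]⟩

/-- The normal ordering isomorphism between symbols and differential operators. -/
def fullSymbolEquiv (n : ℕ) : Pol n ≃ₗ[ℂ] DiffOp n :=
  LinearEquiv.ofBijective ((fullSymbolMap n).codRestrict (DiffOp n).toSubmodule fullSymbolMap_mem)
    ⟨fun p q h => fullSymbolMap_injective (congrArg Subtype.val h), fun T => by
      obtain ⟨q, hq⟩ := exists_mul_fullSymbolMap T.2 1
      refine ⟨q, Subtype.ext (hq.trans ?_)⟩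
      rw [← MvPolynomial.C_1, fullSymbolMap_C, mulOp_one, mul_one]⟩

theorem coe_fullSymbolEquiv (p : Pol n) :
    (fullSymbolEquiv n p : Module.End ℂ (Smooth n)) = fullSymbolMap n p := rfl

/-! ### The Lie derivative in terms of full symbols -/

theorem lieDensity_add (lam : ℂ) (x y : Matrix (Fin (n + 1)) (Fin (n + 1)) ℝ) :
    (lieDensity lam (x + y) : Module.End ℂ (Smooth n)) = lieDensity lam x + lieDensity lam y := by
  simp only [lieDensity, vf_add, mulOp_add, map_add, add_mul, Finset.sum_add_distrib, smul_add]
  abel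

theorem lieDensity_single_succ (lam : ℂ) (k : Fin n) (b : Fin (n + 1)) (r : ℝ) :
    lieDensity lam (Matrix.single k.succ b r) = (r : ℂ) • (mulOp (homCoord n b) * pd k +
      lam • mulOp (pd k (homCoord n b))) := by
  have h1 : ∑ i, mulOp (vf (Matrix.single k.succ b r) i) * pd i =
      (r : ℂ) • (mulOp (homCoord n b) * pd k) := by
    rw [Finset.sum_eq_single k (by simp +contextual [vf_single_succ, mulOp_zero]) (by simp),
      vf_single_succ, if_pos rfl, mulOp_smul, smul_mul_assoc]
  have h2 : ∑ i, pd i (vf (Matrix.single k.succ b r) i) = (r : ℂ) • pd k (homCoord n b) := by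
    rw [Finset.sum_eq_single k (by simp +contextual [vf_single_succ]) (by simp),
      vf_single_succ, if_pos rfl, map_smul]
  rw [lieDensity, h1, h2, mulOp_smul, smul_add, smul_comm lam]

theorem lieDensity_single_zero (lam : ℂ) (b : Fin (n + 1)) (r : ℝ) :
    lieDensity lam (Matrix.single 0 b r : Matrix (Fin (n + 1)) (Fin (n + 1)) ℝ) =
      -(r : ℂ) • (∑ i, mulOp (coord i * homCoord n b) * pd i +
        lam • mulOp (∑ i, pd i (coord i * homCoord n b))) := by
  simp only [lieDensity, vf_single_zero, mulOp_smul, map_smul, smul_mul_assoc, ← Finset.smul_sum,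
    smul_add, smul_comm lam]

theorem smul_commutator (c : ℂ) (S T : Module.End ℂ (Smooth n)) :
    c • S * T - T * c • S = c • (S * T - T * S) := by
  rw [smul_mul_assoc, mul_smul_comm]
  exact (smul_sub c (S * T) (T * S)).symm

theorem sum_pd_coord_mul_one : ∑ i, pd i (coord i * (1 : Smooth n)) = (n : ℂ) • 1 := by
  simp [pd_coord, Nat.cast_smul_eq_nsmul]

theorem sum_pd_coord_mul_coord (j : Fin n) :
    ∑ i, pd i (coord i * coord j) = ((n : ℂ) + 1) • coord j := by
  simp [pd_coord, pd_mul, add_smul, Nat.cast_smul_eq_nsmul, Finset.sum_add_distrib]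

/-- The commutator with the Lie derivative, transported to full symbols. -/
theorem lieDensity_commutator (lam : ℂ) (x : Matrix (Fin (n + 1)) (Fin (n + 1)) ℝ) (p : Pol n) :
    lieDensity lam x * fullSymbolMap n p - fullSymbolMap n p * lieDensity lam x =
      fullSymbolMap n (act x p + ∑ j : Fin n, (x 0 j.succ : ℂ) •
        (euler n (dXi j p) + (lam * (n + 1)) • dXi j p)) := by
  classical
  induction x using Matrix.induction_on with
  | h_add x y hx hy =>
    have h : act (x + y) p + ∑ j : Fin n, ((x + y) 0 j.succ : ℂ) •
        (euler n (dXi j p) + (lam * (n + 1)) • dXi j p) =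
      (act x p + ∑ j : Fin n, (x 0 j.succ : ℂ) •
        (euler n (dXi j p) + (lam * (n + 1)) • dXi j p)) +
      (act y p + ∑ j : Fin n, (y 0 j.succ : ℂ) •
        (euler n (dXi j p) + (lam * (n + 1)) • dXi j p)) := by
      rw [act_add, LinearMap.add_apply]
      simp only [Matrix.add_apply, Complex.ofReal_add, add_smul (x 0 _ : ℂ),
        Finset.sum_add_distrib]
      abel
    rw [h, map_add, ← hx, ← hy, lieDensity_add, add_mul, mul_add]
    abel
  | h_std_basis a b r =>
    have hleft : ∀ (f : Smooth n) (i : Fin n), mulOp f * pd i * fullSymbolMap n p =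
        fullSymbolMap n (C f * (X i * p + dU i p)) := fun f i => by
      rw [mul_assoc, pd_mul_fullSymbolMap, fullSymbolMap_C_mul]
    refine Fin.cases (Fin.cases ?_ (fun j => ?_) b) (fun k => Fin.cases ?_ (fun j => ?_) b) a
    · have h : ∑ j : Fin n, ((Matrix.single 0 0 r : Matrix (Fin (n + 1)) _ ℝ) 0 j.succ : ℂ) •
          (euler n (dXi j p) + (lam * (n + 1)) • dXi j p) = 0 :=
        Finset.sum_eq_zero fun j _ => by simp [(Fin.succ_ne_zero j).symm]
      have hright : ∀ i, fullSymbolMap n p * (mulOp (coord i) * pd i) =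
          fullSymbolMap n (X i * (uC i * p + dXi i p)) := fun i => by
        rw [← mul_assoc, fullSymbolMap_mul_coord, ← fullSymbolMap_X_mul]
      rw [h, add_zero, act_single_zero_zero, lieDensity_single_zero, homCoord_zero,
        sum_pd_coord_mul_one, mulOp_smul, mulOp_one, map_smul, smul_commutator, add_mul, mul_add,
        Finset.sum_mul, Finset.mul_sum]
      simp only [mul_one, hleft, hright, smul_mul_assoc, mul_smul_comm, one_mul]
      rw [add_sub_add_right_eq_sub, ← map_sum, ← map_sum, ← map_sub, baseEuler_apply, euler_apply,
        ← Finset.sum_sub_distrib, ← Finset.sum_sub_distrib]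
      exact congrArg _ (congrArg _ (Finset.sum_congr rfl fun i _ => by ring))
    · have h : ∑ i : Fin n, ((Matrix.single 0 j.succ r : Matrix (Fin (n + 1)) _ ℝ) 0 i.succ : ℂ) •
          (euler n (dXi i p) + (lam * (n + 1)) • dXi i p) =
            (r : ℂ) • (euler n (dXi j p) + (lam * (n + 1)) • dXi j p) := by
        rw [Finset.sum_eq_single j (fun i _ hi => by simp [hi.symm]) (by simp)]
        simp
      have hright : ∀ i, fullSymbolMap n p * (mulOp (coord i * coord j) * pd i) =
          fullSymbolMap n (X i * (uC j * (uC i * p + dXi i p) + dXi j (uC i * p + dXi i p))) :=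
        fun i => by
          rw [← mul_assoc, mulOp_mul, ← mul_assoc, fullSymbolMap_mul_coord,
            fullSymbolMap_mul_coord, ← fullSymbolMap_X_mul]
      -- The divergence of the quadratic field is a multiple `n + 1` of `uⱼ`; its commutator
      -- supplies the term `λ(n+1) ∂/∂ξⱼ`.
      have hdiv : mulOp (coord j) * fullSymbolMap n p - fullSymbolMap n p * mulOp (coord j) =
          fullSymbolMap n (-dXi j p) := by
        rw [fullSymbolMap_mul_coord, map_add, fullSymbolMap_C_mul, map_neg]
        abel
      -- Carrying `uᵢuⱼ` across the operator differentiates twice in `ξ`; the second-order terms `ξᵢ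
      -- ∂²/∂ξᵢ∂ξⱼ` add up to `E ∂/∂ξⱼ`, the part of the defect independent of `λ`.
      have hsum : ∑ i, C (coord i * coord j) * (X i * p + dU i p) -
          ∑ i, X i * (uC j * (uC i * p + dXi i p) + dXi j (uC i * p + dXi i p)) =
          uC j * (baseEuler n p - euler n p) - pairing n * dXi j p - euler n (dXi j p) := by
        rw [baseEuler_apply, euler_apply, euler_apply, pairing, Finset.sum_mul]
        simp only [← Finset.sum_sub_distrib, Finset.mul_sum]
        refine Finset.sum_congr rfl fun i _ => ?_
        rw [map_add, dXi_uC_mul, map_mul, dXi_dXi_comm j i]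
        ring
      rw [h, act_single_zero_succ, lieDensity_single_zero, homCoord_succ,
        sum_pd_coord_mul_coord, smul_commutator, add_mul, mul_add, Finset.sum_mul,
        Finset.mul_sum, add_sub_add_comm, smul_commutator, mulOp_smul, smul_commutator, hdiv]
      simp only [hleft, hright]
      rw [← map_sum, ← map_sum, ← map_sub, hsum, ← map_smul, ← map_smul, ← map_add, ← map_smul]
      exact congrArg _ (by module)
    · have hright : fullSymbolMap n p * pd k = fullSymbolMap n (X k * p) := by
        rw [fullSymbolMap_X_mul]
      have h : ∑ i : Fin n, ((Matrix.single k.succ 0 r : Matrix (Fin (n + 1)) _ ℝ) 0 i.succ : ℂ) •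
          (euler n (dXi i p) + (lam * (n + 1)) • dXi i p) = 0 :=
        Finset.sum_eq_zero fun j _ => by simp
      rw [h, add_zero, act_single_succ_zero, lieDensity_single_succ, homCoord_zero, pd_one,
        mulOp_zero, mulOp_one, smul_zero, add_zero, one_mul, smul_commutator, hright, pd_mul_fullSymbolMap, map_smul, ← map_sub, add_sub_cancel_left]
    · have hright : fullSymbolMap n p * (mulOp (coord j) * pd k) =
          fullSymbolMap n (X k * (uC j * p + dXi j p)) := by
        rw [← mul_assoc, fullSymbolMap_mul_coord, fullSymbolMap_X_mul]
      have h : ∑ i : Fin n, ((Matrix.single k.succ j.succ r : Matrix (Fin (n + 1)) _ ℝ)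
          0 i.succ : ℂ) • (euler n (dXi i p) + (lam * (n + 1)) • dXi i p) = 0 :=
        Finset.sum_eq_zero fun j _ => by simp
      have hc : mulOp (pd k (coord j)) * fullSymbolMap n p =
          fullSymbolMap n p * mulOp (pd k (coord j)) := by
        rw [pd_coord]
        split_ifs
        · rw [mulOp_one, one_mul, mul_one]
        · rw [mulOp_zero, zero_mul, mul_zero]
      rw [h, add_zero, act_single_succ_succ, lieDensity_single_succ, homCoord_succ,
        smul_commutator, add_mul, mul_add, smul_mul_assoc, hc,
        mul_smul_comm, add_sub_add_right_eq_sub, hleft, hright, map_smul, ← map_sub]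
      exact congrArg _ (congrArg _ (by ring))

/-! ### The operator `g_λ` at `t = 1` -/

/-- The eigenvalue of `gCoeff n lam d` on symbols of degree `m`. -/
def gScalar (n : ℕ) (lam : ℂ) (d m : ℕ) : ℂ :=
  ((d.factorial : ℂ)⁻¹) * ∏ j ∈ Finset.range d,
    ((-(m : ℂ) - (j + lam * (n + 1))) * (2 * (m : ℂ) + (j + n + 1))⁻¹)

theorem den_scalar_ne_zero (n j m : ℕ) : (2 * (m : ℂ) + (j + n + 1)) ≠ 0 := by
  have : ((2 * m + (j + n + 1) : ℕ) : ℂ) ≠ 0 := Nat.cast_ne_zero.2 (by omega)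
  exact_mod_cast this

/-- The only property of the product formula that the intertwining needs, besides `g₀ = 1`. -/
theorem gScalar_succ (n : ℕ) (lam : ℂ) (d m : ℕ) :
    gScalar n lam (d + 1) m * ((d + 1) * (2 * (m : ℂ) + (d + n + 1))) =
      gScalar n lam d m * (-(m : ℂ) - (d + lam * (n + 1))) := by
  have h2 : (d : ℂ) + 1 ≠ 0 := Nat.cast_add_one_ne_zero d
  have h3 := den_scalar_ne_zero n d m
  rw [gScalar, gScalar, Finset.prod_range_succ, Nat.factorial_succ, Nat.cast_mul, mul_inv,
    Nat.cast_add_one]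
  have h4 : ((d : ℂ) + 1)⁻¹ * (d + 1) * ((2 * (m : ℂ) + (d + n + 1))⁻¹ *
      (2 * (m : ℂ) + (d + n + 1))) = 1 := by
    rw [inv_mul_cancel₀ h2, inv_mul_cancel₀ h3, one_mul]
  linear_combination ((d.factorial : ℂ)⁻¹ * (∏ j ∈ Finset.range d,
    ((-(m : ℂ) - (j + lam * (n + 1))) * (2 * (m : ℂ) + (j + n + 1))⁻¹)) *
    (-(m : ℂ) - (d + lam * (n + 1)))) * h4

theorem coeff_den_inv (j : ℕ) (p : Pol n) (b : Fin n →₀ ℕ) :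
    coeff b ((↑(isUnit_den n j).unit⁻¹ : Module.End ℂ (Pol n)) p) =
      (2 * (b.degree : ℂ) + (j + n + 1))⁻¹ • coeff b p := by
  rw [eq_inv_smul_iff₀ (den_scalar_ne_zero n j b.degree), ← coeff_den]
  have h : den n j * (↑(isUnit_den n j).unit⁻¹ : Module.End ℂ (Pol n)) = 1 :=
    (isUnit_den n j).mul_val_inv
  exact congrArg (coeff b) (LinearMap.congr_fun h p)

theorem coeff_gCoeff (lam : ℂ) (d : ℕ) (p : Pol n) (b : Fin n →₀ ℕ) :
    coeff b (gCoeff n lam d p) = gScalar n lam d b.degree • coeff b p := by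
  rw [gCoeff, LinearMap.smul_apply, MvPolynomial.coeff_smul, gScalar, mul_smul]
  congr 1
  induction d generalizing p with
  | zero => simp
  | succ d ih =>
    rw [List.range_succ, List.map_append, List.prod_append, List.map_singleton,
      List.prod_singleton, Module.End.mul_apply, ih, Module.End.mul_apply, Finset.prod_range_succ,
      mul_smul, mul_smul]
    simp [coeff_euler, coeff_den_inv, sub_smul]

theorem commute_gCoeff {T : Module.End ℂ (Pol n)} (hT : Commute T (euler n)) (lam : ℂ) (d : ℕ) :
    Commute T (gCoeff n lam d) := by
  refine Commute.smul_right (Commute.list_prod_right _ _ fun y hy => ?_) _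
  obtain ⟨j, -, rfl⟩ := List.mem_map.1 hy
  refine Commute.mul_right (hT.neg_right.sub_right ((Commute.one_right T).smul_right _)) ?_
  refine Commute.units_inv_right ?_
  exact (hT.smul_right _).add_right ((Commute.one_right T).smul_right _)

theorem gCoeff_zero (lam : ℂ) : gCoeff n lam 0 = 1 := by
  simp [gCoeff]

theorem DegLT.map_gCoeff {d : ℕ} {p : Pol n} (h : DegLT d p) (lam : ℂ) (k : ℕ) :
    DegLT d (gCoeff n lam k p) := fun a ha => by
  rw [coeff_gCoeff, h a ha, smul_zero]

theorem DegLT.map_opD_pow {d k : ℕ} {p : Pol n} (h : DegLT (d + k) p) : DegLT d ((opD n ^ k) p) := by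
  induction k generalizing d with
  | zero => simpa using h
  | succ k ih =>
    rw [pow_succ', Module.End.mul_apply]
    exact (ih (by rwa [add_right_comm, add_assoc])).map_opD

/-- The operator `Σ_d g_{λ,d} Dᵈ`; the sum is finite on each symbol. -/
def gMap (n : ℕ) (lam : ℂ) (p : Pol n) : Pol n :=
  ∑ d ∈ Finset.range (p.totalDegree + 1), gCoeff n lam d ((opD n ^ d) p)

/-- `Dᵈ` kills symbols of degree below `d`, so any cut-off above the degree gives the same sum. A
common cut-off is what makes `gMap` visibly linear. -/
theorem gMap_eq_sum (lam : ℂ) {M : ℕ} {p : Pol n} (h : DegLT M p) :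
    gMap n lam p = ∑ d ∈ Finset.range M, gCoeff n lam d ((opD n ^ d) p) := by
  have key : ∀ {K : ℕ}, DegLT K p → ∀ {L : ℕ}, K ≤ L →
      ∑ d ∈ Finset.range K, gCoeff n lam d ((opD n ^ d) p) =
        ∑ d ∈ Finset.range L, gCoeff n lam d ((opD n ^ d) p) := fun {K} hK {L} hL => by
    refine Finset.sum_subset (Finset.range_mono hL) fun d _ hd => ?_
    rw [Finset.mem_range, not_lt] at hd
    have h0 : (opD n ^ d) p = 0 := degLT_zero (DegLT.map_opD_pow (by simpa using hK.mono hd))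
    rw [h0, map_zero]
  rw [gMap, key (degLT_totalDegree p) (le_max_left _ M), key h (le_max_right _ M)]

theorem gMap_add (lam : ℂ) (p q : Pol n) : gMap n lam (p + q) = gMap n lam p + gMap n lam q := by
  have hp := (degLT_totalDegree p).mono (le_max_left _ (q.totalDegree + 1))
  have hq := (degLT_totalDegree q).mono (le_max_right (p.totalDegree + 1) _)
  rw [gMap_eq_sum lam hp, gMap_eq_sum lam hq, gMap_eq_sum lam (hp.add hq),
    ← Finset.sum_add_distrib]
  simp only [map_add]

theorem gMap_smul (lam c : ℂ) (p : Pol n) : gMap n lam (c • p) = c • gMap n lam p := by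
  have hp := degLT_totalDegree p
  have hc : DegLT (p.totalDegree + 1) (c • p) := fun a ha => by
    rw [MvPolynomial.coeff_smul, hp a ha, smul_zero]
  rw [gMap_eq_sum lam hp, gMap_eq_sum lam hc, Finset.smul_sum]
  simp only [map_smul]

/-- The term `d = 0` is the identity and every other term lowers the degree: `g_λ` is unipotent. -/
theorem gMap_sub_self (lam : ℂ) {d : ℕ} {p : Pol n} (h : DegLT (d + 1) p) :
    DegLT d (gMap n lam p - p) := by
  rw [gMap_eq_sum lam h, Finset.sum_range_succ', pow_zero, gCoeff_zero, Module.End.one_apply,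
    Module.End.one_apply, add_sub_cancel_right]
  exact DegLT.sum fun k _ =>
    DegLT.map_gCoeff (DegLT.map_opD_pow (h.mono (by omega))) lam (k + 1)

theorem gMap_eq_self (lam : ℂ) {p : Pol n} (h : opD n p = 0) : gMap n lam p = p := by
  rw [gMap, Finset.sum_range_succ', pow_zero, gCoeff_zero, Module.End.one_apply,
    Module.End.one_apply, Finset.sum_eq_zero, zero_add]
  intro k _
  rw [pow_succ, Module.End.mul_apply, h, map_zero, map_zero]

theorem exists_gMap_eq (lam : ℂ) (d : ℕ) : ∀ p : Pol n, DegLT d p →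
    ∃ q, DegLT d q ∧ gMap n lam q = p := by
  induction d with
  | zero => exact fun p hp => ⟨p, hp, by rw [degLT_zero hp]; exact gMap_eq_self lam (map_zero _)⟩
  | succ d ih =>
    intro p hp
    obtain ⟨r, hr, hrp⟩ := ih _ (gMap_sub_self lam hp)
    -- Here `r` is a preimage of the lower-degree error `g p - p`, so `g (p - r) = p`. The degree
    -- bound is kept for the principal symbol condition.
    refine ⟨p - r, hp.sub (hr.mono d.le_succ), ?_⟩
    have h := gMap_add lam (p - r) r
    rw [sub_add_cancel, hrp] at h
    linear_combination -h

theorem eq_zero_of_gMap_eq_zero (lam : ℂ) {p : Pol n} (h : gMap n lam p = 0) : p = 0 := by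
  have key : ∀ d, DegLT d p → p = 0 := fun d => by
    induction d with
    | zero => exact degLT_zero
    | succ d ih =>
      intro hp
      have h1 := gMap_sub_self lam hp
      rw [h, zero_sub] at h1
      exact ih fun a ha => neg_eq_zero.1 (h1 a ha)
  exact key _ (degLT_totalDegree p)

/-- `g_λ` at `t = 1` is invertible since it is unipotent for the degree filtration. -/
def gEquiv (n : ℕ) (lam : ℂ) : Pol n ≃ₗ[ℂ] Pol n :=
  LinearEquiv.ofBijective
    ({ toFun := gMap n lam, map_add' := gMap_add lam, map_smul' := gMap_smul lam } :
      Pol n →ₗ[ℂ] Pol n)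
    ⟨(injective_iff_map_eq_zero _).2 fun _ h => eq_zero_of_gMap_eq_zero lam h, fun p =>
      let ⟨q, _, hq⟩ := exists_gMap_eq lam _ p (degLT_totalDegree p)
      ⟨q, hq⟩⟩

theorem gEquiv_apply (lam : ℂ) (p : Pol n) : gEquiv n lam p = gMap n lam p := rfl

/-! ### Equivariance -/

theorem den_apply (j : ℕ) (q : Pol n) :
    den n j q = (2 : ℂ) • euler n q + ((j : ℂ) + n + 1) • q := rfl

theorem opD_den (j : ℕ) (q : Pol n) :
    opD n (den n j q) = den n j (opD n q) + (2 : ℂ) • opD n q := by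
  rw [den_apply, den_apply, map_add, map_smul, map_smul, opD_euler]
  module

theorem opD_pow_dXi (d : ℕ) (j : Fin n) (q : Pol n) :
    (opD n ^ d) (dXi j q) = dXi j ((opD n ^ d) q) := by
  induction d with
  | zero => rfl
  | succ d ih => rw [pow_succ', Module.End.mul_apply, ih, opD_dXi, Module.End.mul_apply]

theorem opD_pow_euler (d : ℕ) (q : Pol n) :
    (opD n ^ d) (euler n q) = euler n ((opD n ^ d) q) + (d : ℂ) • (opD n ^ d) q := by
  induction d with
  | zero => simp
  | succ d ih =>
    rw [pow_succ', Module.End.mul_apply, ih, map_add, opD_euler, Module.End.mul_apply, map_smul,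
      Nat.cast_add_one]
    module

/-- Each of the `d + 1` factors `D` contributes one defect. Moving `i` further factors past it turns
`2E + n + 1` into `2E + 2i + n + 1`, and the sum over `i = 0, …, d` is `(d+1)(2E + d + n + 1)`. -/
theorem opD_pow_succ_act (d : ℕ) (x : Matrix (Fin (n + 1)) (Fin (n + 1)) ℝ) (q : Pol n) :
    (opD n ^ (d + 1)) (act x q) = act x ((opD n ^ (d + 1)) q) +
      ∑ j : Fin n, (x 0 j.succ : ℂ) • ((d : ℂ) + 1) • den n d ((opD n ^ d) (dXi j q)) := by
  induction d with
  | zero => simp [opD_act]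
  | succ d ih =>
    rw [pow_succ' _ (d + 1), Module.End.mul_apply, ih, map_add, opD_act, add_assoc,
      Module.End.mul_apply, map_sum, ← Finset.sum_add_distrib]
    refine congrArg _ (Finset.sum_congr rfl fun j _ => ?_)
    rw [← opD_pow_dXi, map_smul, map_smul, opD_den, ← smul_add, pow_succ', Module.End.mul_apply]
    congr 1
    rw [den_apply, den_apply, den_apply, Nat.cast_add_one, Nat.cast_zero]
    module

theorem gCoeff_succ_den (lam : ℂ) (d : ℕ) (q : Pol n) :
    ((d : ℂ) + 1) • gCoeff n lam (d + 1) (den n d q) =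
      -gCoeff n lam d (euler n q + ((d : ℂ) + lam * (n + 1)) • q) := by
  ext1 b
  simp only [MvPolynomial.coeff_smul, MvPolynomial.coeff_neg, coeff_gCoeff, coeff_den,
    MvPolynomial.coeff_add, coeff_euler, smul_smul, ← add_smul, ← neg_smul]
  congr 1
  linear_combination gScalar_succ n lam d b.degree

/-- `g_λ` intertwines the action on full symbols with the Hamiltonian action on symbols. -/
theorem gMap_act (lam : ℂ) (x : Matrix (Fin (n + 1)) (Fin (n + 1)) ℝ) (p : Pol n) :
    gMap n lam (act x p + ∑ j : Fin n, (x 0 j.succ : ℂ) •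
        (euler n (dXi j p) + (lam * (n + 1)) • dXi j p)) = act x (gMap n lam p) := by
  set B := ∑ j : Fin n, (x 0 j.succ : ℂ) •
    (euler n (dXi j p) + (lam * (n + 1)) • dXi j p) with hB
  -- The cut-off for `B` is one less, so that `Dᵈ B` is matched with `Dᵈ⁺¹ (act x p)` once the term
  -- of order `0` is split off.
  obtain ⟨K, hp, hap, hb⟩ : ∃ K, DegLT (K + 1) p ∧ DegLT (K + 1) (act x p) ∧ DegLT K B :=
    ⟨p.totalDegree + (act x p).totalDegree + B.totalDegree + 1,
      (degLT_totalDegree p).mono (by omega), (degLT_totalDegree _).mono (by omega),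
      (degLT_totalDegree B).mono (by omega)⟩
  have hcomm : ∀ d q, gCoeff n lam d (act x q) = act x (gCoeff n lam d q) := fun d q =>
    (LinearMap.congr_fun (commute_gCoeff (LinearMap.ext (act_euler x)) lam d).eq q).symm
  rw [gMap_add, gMap_eq_sum lam hp, gMap_eq_sum lam hap, gMap_eq_sum lam hb,
    Finset.sum_range_succ', Finset.sum_range_succ', map_add, map_sum, add_right_comm,
    ← Finset.sum_add_distrib]
  congr 1
  · refine Finset.sum_congr rfl fun d _ => ?_
    rw [opD_pow_succ_act, map_add, hcomm, add_assoc, hB, map_sum, map_sum, map_sum,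
      ← Finset.sum_add_distrib, Finset.sum_eq_zero, add_zero]
    intro j _
    -- The defect of `Dᵈ⁺¹` cancels `g_d Dᵈ B`; the shift `+ d` in the numerator comes from `Dᵈ E =
    -- (E + d) Dᵈ`.
    rw [map_smul, map_smul, gCoeff_succ_den, map_smul, map_smul, ← smul_add]
    simp only [map_add, map_smul, opD_pow_euler]
    module
  · rw [pow_zero, Module.End.one_apply, Module.End.one_apply, hcomm]

/-! ### Existence and uniqueness of the equivariant quantization -/

/-- The equivariant quantization: normal ordering after the inverse of `g_λ` at `t = 1`. -/
def projQuant (n : ℕ) (lam : ℂ) : Pol n ≃ₗ[ℂ] DiffOp n :=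
  (gEquiv n lam).symm.trans (fullSymbolEquiv n)

theorem projQuant_gMap (lam : ℂ) (p : Pol n) :
    projQuant n lam (gMap n lam p) = fullSymbolEquiv n p := by
  rw [projQuant, LinearEquiv.trans_apply, ← gEquiv_apply, LinearEquiv.symm_apply_apply]

theorem coe_projQuant_gMap (lam : ℂ) (p : Pol n) :
    (projQuant n lam (gMap n lam p) : Module.End ℂ (Smooth n)) = fullSymbolMap n p := by
  rw [projQuant_gMap, coe_fullSymbolEquiv]

theorem degLT_of_isHomogeneous {d : ℕ} {p : Pol n} (h : p.IsHomogeneous d) : DegLT (d + 1) p :=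
  fun _ ha => h.coeff_eq_zero (by omega)

/-- Writing `φ = g q`, the operator has full symbol `q`, which differs from `φ` in lower degree
only. Equivariance is `gMap_act` read through `lieDensity_commutator`. -/
theorem isEquivariantQuantization_projQuant (n : ℕ) (lam : ℂ) :
    IsEquivariantQuantization lam (projQuant n lam) where
  symbol d φ hφ := by
    obtain ⟨q, hq, rfl⟩ := exists_gMap_eq lam _ φ (degLT_of_isHomogeneous hφ)
    refine ⟨hφ, q - gMap n lam q, fun a ha => ?_, ?_⟩
    · by_contra hd
      have h := gMap_sub_self lam hq a (not_lt.1 hd)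
      rw [MvPolynomial.mem_support_iff, ← neg_sub, MvPolynomial.coeff_neg, h, neg_zero] at ha
      exact ha rfl
    · rw [coe_projQuant_gMap, add_sub_cancel, fullSymbolMap_apply]
  equivariant x φ := by
    obtain ⟨q, -, rfl⟩ := exists_gMap_eq lam _ φ (degLT_totalDegree φ)
    rw [poisson_momentum, ← gMap_act, coe_projQuant_gMap, coe_projQuant_gMap,
      lieDensity_commutator]

/-! ### Uniqueness through the Casimir element. -/

/-- Subtracting the trace part changes nothing, as scalars act by zero. The extension is needed
because the Casimir is written in matrix units of `gl(n+1)`. -/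
theorem commute_act_of_commute_sl {T : Pol n →ₗ[ℂ] Pol n}
    (hT : ∀ (x : LieAlgebra.SpecialLinear.sl (Fin (n + 1)) ℝ) (p : Pol n),
      T (act (x : Matrix (Fin (n + 1)) (Fin (n + 1)) ℝ) p) =
        act (x : Matrix (Fin (n + 1)) (Fin (n + 1)) ℝ) (T p))
    (y : Matrix (Fin (n + 1)) (Fin (n + 1)) ℝ) (p : Pol n) : T (act y p) = act y (T p) := by
  set c : ℝ := y.trace / (n + 1)
  have hn : (n : ℝ) + 1 ≠ 0 := by positivity
  have htr : Matrix.trace (y - c • (1 : Matrix (Fin (n + 1)) (Fin (n + 1)) ℝ)) = 0 := by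
    simp [Matrix.trace_sub, Matrix.trace_smul, c, div_mul_cancel₀ _ hn]
  have h := hT ⟨y - c • 1, htr⟩ p
  have hy : (act y : Module.End ℂ (Pol n)) = act (y - c • 1) := by
    conv_lhs => rw [← sub_add_cancel y (c • 1), act_add, act_smul_one, add_zero]
  rw [hy]
  exact h

/-- An operator that commutes with the action preserves the fibre degree, since the Casimir element
separates degrees. -/
theorem isHomogeneous_of_commute_act {T : Pol n →ₗ[ℂ] Pol n}
    (hT : ∀ (y : Matrix (Fin (n + 1)) (Fin (n + 1)) ℝ) (p : Pol n), T (act y p) = act y (T p))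
    {d : ℕ} {φ : Pol n} (hφ : φ.IsHomogeneous d) : (T φ).IsHomogeneous d := by
  have hmul : ∀ (k : ℕ) (p : Pol n), T (k * p) = k * T p := fun k p => by
    rw [← nsmul_eq_mul, ← nsmul_eq_mul, map_nsmul]
  have hE : euler n φ = (d : Pol n) * φ := by
    rw [euler_apply, ← nsmul_eq_mul]
    exact hφ.sum_X_mul_pderiv
  have h1 := congrArg T (casimir_act φ)
  have h2 := casimir_act (T φ)
  have hL : T (2 * ∑ i : Fin n, act (Matrix.single i.succ 0 1)
        (act (Matrix.single 0 i.succ (-1)) φ) -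
      ∑ k : Fin n, ∑ j : Fin n,
        act (Matrix.single k.succ j.succ 1) (act (Matrix.single j.succ k.succ 1) φ) -
      act (Matrix.single 0 0 1) (act (Matrix.single 0 0 1) φ) +
      (n + 1) * act (Matrix.single 0 0 1) φ) =
      2 * ∑ i : Fin n, act (Matrix.single i.succ 0 1) (act (Matrix.single 0 i.succ (-1)) (T φ)) -
      ∑ k : Fin n, ∑ j : Fin n,
        act (Matrix.single k.succ j.succ 1) (act (Matrix.single j.succ k.succ 1) (T φ)) -
      act (Matrix.single 0 0 1) (act (Matrix.single 0 0 1) (T φ)) +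
      (n + 1) * act (Matrix.single 0 0 1) (T φ) := by
    have e2 := hmul 2
    have en := hmul (n + 1)
    push_cast at e2 en
    simp only [map_add, map_sub, map_sum, e2, en, hT]
  have hR : T (-2 * (euler n (euler n φ) + n * euler n φ)) =
      -2 * ((d : Pol n) * (d * T φ) + n * (d * T φ)) := by
    have e : -2 * (euler n (euler n φ) + n * euler n φ) =
        -(((2 * (d * d + n * d) : ℕ) : Pol n) * φ) := by
      have hE2 : euler n ((d : Pol n) * φ) = d * (d * φ) := by
        rw [← nsmul_eq_mul, map_nsmul, hE, ← nsmul_eq_mul, ← nsmul_eq_mul]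
      rw [hE, hE2]
      push_cast
      ring
    rw [e, map_neg, hmul]
    push_cast
    ring
  rw [hL, h2, hR] at h1
  have h3 : euler n (euler n (T φ)) + n * euler n (T φ) =
      (d : Pol n) * (d * T φ) + n * (d * T φ) := by
    have h4 : (2 : ℂ) • (euler n (euler n (T φ)) + n * euler n (T φ)) =
        (2 : ℂ) • ((d : Pol n) * (d * T φ) + n * (d * T φ)) := by
      rw [two_smul, two_smul]
      linear_combination -h1
    exact smul_right_injective _ (two_ne_zero' ℂ) h4
  intro b hb
  have h5 := congrArg (coeff b) h3
  simp only [← nsmul_eq_mul, MvPolynomial.coeff_add, MvPolynomial.coeff_smul, coeff_euler,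
    ← Nat.cast_smul_eq_nsmul ℂ, smul_smul, ← add_smul] at h5
  rw [← sub_eq_zero, ← sub_smul, smul_eq_zero] at h5
  have h6 := sub_eq_zero.1 (h5.resolve_right hb)
  rw [smul_eq_mul, smul_eq_mul] at h6
  -- At a nonzero coefficient the Casimir eigenvalues agree, and `e ↦ (e + n) e` is strictly
  -- increasing on the natural numbers.
  have h7 : (b.degree + n) * b.degree = (d + n) * d := by exact_mod_cast h6
  have h8 : b.degree = d := by
    rcases lt_trichotomy b.degree d with h | h | h
    · nlinarith
    · exact h
    · nlinarith
  rw [← h8, Finsupp.degree_eq_weight_one]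
  rfl

/-- With `T` the comparison of the two quantizations, `T φ - φ` is homogeneous of degree `d` by the
Casimir argument and of degree below `d` by the symbol condition, hence zero. -/
theorem eq_projQuant {lam : ℂ} {Q : Pol n ≃ₗ[ℂ] DiffOp n} (hQ : IsEquivariantQuantization lam Q) :
    Q = projQuant n lam := by
  have hP := isEquivariantQuantization_projQuant n lam
  let T : Pol n →ₗ[ℂ] Pol n := (Q.trans (projQuant n lam).symm).toLinearMap
  have hPT : ∀ p, projQuant n lam (T p) = Q p := fun p =>
    (projQuant n lam).apply_symm_apply (Q p)
  have hT := commute_act_of_commute_sl (T := T) fun x p => by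
    apply (projQuant n lam).injective
    apply Subtype.ext
    rw [hPT, ← poisson_momentum, ← poisson_momentum, hP.equivariant, hQ.equivariant, hPT]
  have hhom : ∀ (d : ℕ) (φ : Pol n), φ.IsHomogeneous d → T φ = φ := fun d φ hφ => by
    obtain ⟨-, r, hr, hQr⟩ := hQ.symbol d φ hφ
    have hr' : DegLT d r := fun a ha => by
      by_contra h
      exact absurd (hr a (MvPolynomial.mem_support_iff.2 h)) (not_lt.2 ha)
    have hTφ : T φ = gMap n lam (φ + r) := by
      apply (projQuant n lam).injective
      apply Subtype.ext
      rw [hPT, coe_projQuant_gMap, hQr, fullSymbolMap_apply]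
    have hdiff : DegLT d (T φ - φ) := by
      have h1 := gMap_sub_self lam
        ((degLT_of_isHomogeneous hφ).add (hr'.mono d.le_succ))
      rw [← hTφ] at h1
      have h2 := h1.add hr'
      rwa [show T φ - (φ + r) + r = T φ - φ by ring] at h2
    have hh : (T φ - φ).IsHomogeneous d := (isHomogeneous_of_commute_act hT hφ).sub hφ
    refine sub_eq_zero.1 (MvPolynomial.ext _ _ fun a => ?_)
    rcases le_or_gt d a.degree with h | h
    · exact hdiff a h
    · exact hh.coeff_eq_zero h.ne
  refine LinearEquiv.ext fun p => ?_
  rw [← hPT p, ← MvPolynomial.sum_homogeneousComponent p, map_sum T]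
  exact congrArg _ (Finset.sum_congr rfl fun i _ =>
    hhom i _ (MvPolynomial.homogeneousComponent_isHomogeneous i p))

/-! ### The star product -/

/-- A term of fibre degree `d` in the coefficient of `tᵐ` lands in `t^(d+m)`. The range on the right
depends on `k` alone, so different arguments can be compared. -/
theorem coeff_quantT (Q : Pol n ≃ₗ[ℂ] DiffOp n) (P : (Pol n)[X]) (k : ℕ) :
    (quantT Q P).coeff k = Q (∑ m ∈ Finset.range (k + 1),
      MvPolynomial.homogeneousComponent (k - m) (P.coeff m)) := by
  have hin : ∀ (m : ℕ) (φ : Pol n), (∑ d ∈ Finset.range (φ.totalDegree + 1),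
      Polynomial.monomial (d + m) (Q (MvPolynomial.homogeneousComponent d φ))).coeff k =
        if m ≤ k then Q (MvPolynomial.homogeneousComponent (k - m) φ) else 0 := fun m φ => by
    simp only [Polynomial.finsetSum_coeff, Polynomial.coeff_monomial]
    split_ifs with h
    · rw [Finset.sum_eq_single (k - m)]
      · rw [if_pos (Nat.sub_add_cancel h)]
      · exact fun d _ hd => if_neg (by omega)
      · intro hd
        rw [MvPolynomial.homogeneousComponent_eq_zero _ _
          (by rw [Finset.mem_range] at hd; omega), map_zero, ite_self]
    · exact Finset.sum_eq_zero fun d _ => if_neg (by omega)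
  rw [quantT, Polynomial.sum, Polynomial.finsetSum_coeff, map_sum]
  simp only [hin]
  rw [← Finset.sum_filter]
  refine Finset.sum_subset (fun m hm => ?_) fun m hm hm' => ?_
  · rw [Finset.mem_filter] at hm
    exact Finset.mem_range.2 (by omega)
  · have h0 : P.coeff m = 0 := by
      by_contra h
      exact hm' (Finset.mem_filter.2 ⟨Polynomial.mem_support_iff.2 h,
        Nat.lt_succ_iff.1 (Finset.mem_range.1 hm)⟩)
    rw [h0, map_zero, map_zero]

/-- Within one power `t^k`, terms with different `m` have different fibre degrees `k - m`, so no two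
coefficients mix and injectivity of `Q` suffices. -/
theorem quantT_injective (Q : Pol n ≃ₗ[ℂ] DiffOp n) : Function.Injective (quantT Q) := by
  intro P P' h
  refine Polynomial.ext fun m => MvPolynomial.ext _ _ fun b => ?_
  have key : ∀ R : (Pol n)[X], coeff b (∑ l ∈ Finset.range (b.degree + m + 1),
      MvPolynomial.homogeneousComponent (b.degree + m - l) (R.coeff l)) =
        coeff b (R.coeff m) := fun R => by
    simp only [MvPolynomial.coeff_sum, MvPolynomial.coeff_homogeneousComponent]
    rw [Finset.sum_eq_single m]
    · rw [if_pos (by omega)]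
    · intro l hl hlm
      rw [Finset.mem_range] at hl
      exact if_neg (by omega)
    · intro hm
      exact absurd (Finset.mem_range.2 (by omega)) hm
  have h1 := congrArg (fun R : (DiffOp n)[X] => R.coeff (b.degree + m)) h
  simp only [coeff_quantT] at h1
  rw [← key P, ← key P', Q.injective h1]

theorem coeff_quantT_C (Q : Pol n ≃ₗ[ℂ] DiffOp n) (p : Pol n) (k : ℕ) :
    (quantT Q (Polynomial.C p)).coeff k = Q (MvPolynomial.homogeneousComponent k p) := by
  rw [coeff_quantT, Finset.sum_eq_single 0]
  · rw [Polynomial.coeff_C_zero, Nat.sub_zero]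
  · intro m _ hm
    rw [Polynomial.coeff_C_of_ne_zero hm, map_zero]
  · intro h
    exact absurd (Finset.mem_range.2 (Nat.succ_pos k)) h

theorem quantT_C_C (Q : Pol n ≃ₗ[ℂ] DiffOp n) (f : Smooth n) :
    quantT Q (Polynomial.C (C f)) = Polynomial.C (Q (C f)) := by
  refine Polynomial.ext fun k => ?_
  rw [coeff_quantT_C, Polynomial.coeff_C,
    MvPolynomial.homogeneousComponent_of_mem (MvPolynomial.isHomogeneous_C _ f)]
  split_ifs
  · rfl
  · exact map_zero Q

/-! ### Homogeneous components and the graded form of `g_λ`. -/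

theorem coeff_opD (p : Pol n) (b : Fin n →₀ ℕ) :
    coeff b (opD n p) = ∑ i, pd i (coeff (b + Finsupp.single i 1) p * (b i + 1)) := by
  simp only [opD_apply, MvPolynomial.coeff_sum, coeff_dU, coeff_dXi]

theorem homogeneousComponent_opD (d : ℕ) (p : Pol n) :
    MvPolynomial.homogeneousComponent d (opD n p) =
      opD n (MvPolynomial.homogeneousComponent (d + 1) p) := by
  refine MvPolynomial.ext _ _ fun b => ?_
  simp only [coeff_opD, MvPolynomial.coeff_homogeneousComponent, map_add, Finsupp.degree_single,
    add_left_inj]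
  split_ifs <;> simp

theorem homogeneousComponent_opD_pow (m : ℕ) (d : ℕ) (p : Pol n) :
    MvPolynomial.homogeneousComponent d ((opD n ^ m) p) =
      (opD n ^ m) (MvPolynomial.homogeneousComponent (d + m) p) := by
  induction m generalizing d with
  | zero => rfl
  | succ m ih =>
    rw [pow_succ', Module.End.mul_apply, homogeneousComponent_opD, ih, Module.End.mul_apply,
      add_right_comm, add_assoc]

theorem homogeneousComponent_gCoeff (lam : ℂ) (m d : ℕ) (p : Pol n) :
    MvPolynomial.homogeneousComponent d (gCoeff n lam m p) =
      gCoeff n lam m (MvPolynomial.homogeneousComponent d p) := by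
  refine MvPolynomial.ext _ _ fun b => ?_
  simp only [coeff_gCoeff, MvPolynomial.coeff_homogeneousComponent]
  split_ifs <;> simp

theorem coeff_gOp (lam : ℂ) (p : Pol n) (m : ℕ) :
    (gOp lam p).coeff m = gCoeff n lam m ((opD n ^ m) p) := by
  rw [gOp, Polynomial.coeff_add, Polynomial.finsetSum_coeff]
  simp only [Polynomial.coeff_monomial, Finset.sum_ite_eq', Finset.mem_Icc]
  rcases Nat.eq_zero_or_pos m with rfl | hm
  · simp [gCoeff_zero]
  · rw [Polynomial.coeff_C_of_ne_zero hm.ne', zero_add]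
    split_ifs with h
    · rfl
    · have h0 : (opD n ^ m) p = 0 :=
        degLT_zero (DegLT.map_opD_pow ((degLT_totalDegree p).mono (by omega)))
      rw [h0, map_zero]

/-- The part of `g_m Dᵐ p` of degree `k - m` comes from the degree `k` part of `p`. The coefficient
of `t^k` is therefore `Q` of `g_λ` at `t = 1` on that part, which is its normal ordering. -/
theorem coeff_quantT_gOp (lam : ℂ) (p : Pol n) (k : ℕ) :
    (quantT (projQuant n lam) (gOp lam p)).coeff k =
      fullSymbolEquiv n (MvPolynomial.homogeneousComponent k p) := by
  rw [coeff_quantT, ← projQuant_gMap, gMap_eq_sum lam (degLT_of_isHomogeneous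
    (MvPolynomial.homogeneousComponent_isHomogeneous k p))]
  refine congrArg _ (Finset.sum_congr rfl fun m hm => ?_)
  rw [coeff_gOp, homogeneousComponent_gCoeff, homogeneousComponent_opD_pow,
    Nat.sub_add_cancel (Nat.lt_succ_iff.1 (Finset.mem_range.1 hm))]

theorem projQuant_of_opD_eq_zero (lam : ℂ) {p : Pol n} (h : opD n p = 0) :
    projQuant n lam p = fullSymbolEquiv n p := by
  rw [← projQuant_gMap, gMap_eq_self lam h]

theorem opD_fibrePoly (ψ : MvPolynomial (Fin n) ℂ) : opD n (fibrePoly ψ) = 0 := by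
  have h : ∀ i, dU i (fibrePoly ψ) = 0 := fun i => by
    refine MvPolynomial.ext _ _ fun b => ?_
    rw [coeff_dU, fibrePoly, MvPolynomial.coeff_map, Algebra.algebraMap_eq_smul_one, map_smul,
      pd_one, smul_zero, MvPolynomial.coeff_zero]
  simp only [opD_apply, ← dXi_dU_comm, h, map_zero, Finset.sum_const_zero]

theorem homogeneousComponent_fibrePoly (k : ℕ) (ψ : MvPolynomial (Fin n) ℂ) :
    MvPolynomial.homogeneousComponent k (fibrePoly ψ) =
      fibrePoly (MvPolynomial.homogeneousComponent k ψ) := by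
  refine MvPolynomial.ext _ _ fun b => ?_
  simp only [fibrePoly, MvPolynomial.coeff_homogeneousComponent, MvPolynomial.coeff_map]
  split_ifs <;> simp

/-- `D` kills `φ` and the components of `ψ`, so both factors are quantized by normal ordering; a
function to the left of constant-coefficient derivatives needs no reordering. -/
theorem quantT_gOp (lam : ℂ) (φ : Smooth n) (ψ : MvPolynomial (Fin n) ℂ) :
    quantT (projQuant n lam) (gOp lam (C φ * fibrePoly ψ)) =
      quantT (projQuant n lam) (Polynomial.C (C φ)) *
        quantT (projQuant n lam) (Polynomial.C (fibrePoly ψ)) := by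
  have hφ : opD n (C φ) = 0 := by simp [opD_apply, dXi_C]
  refine Polynomial.ext fun k => ?_
  rw [quantT_C_C, Polynomial.coeff_C_mul, coeff_quantT_C, coeff_quantT_gOp,
    MvPolynomial.homogeneousComponent_C_mul, homogeneousComponent_fibrePoly,
    projQuant_of_opD_eq_zero lam hφ, projQuant_of_opD_eq_zero lam (opD_fibrePoly _)]
  refine Subtype.ext ?_
  rw [coe_fullSymbolEquiv, fullSymbolMap_C_mul, ← fullSymbolMap_C]
  rfl

end ProjStar

end

theorem proposition4 (n : ℕ) (lam : ℂ) :
    (∃! Q : ProjStar.Pol n ≃ₗ[ℂ] ProjStar.DiffOp n, ProjStar.IsEquivariantQuantization lam Q) ∧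
    ∀ Q : ProjStar.Pol n ≃ₗ[ℂ] ProjStar.DiffOp n, ProjStar.IsEquivariantQuantization lam Q →
      Function.Injective (ProjStar.quantT Q) ∧
      ∀ (φ : ProjStar.Smooth n) (ψ : MvPolynomial (Fin n) ℂ),
        ProjStar.quantT Q (ProjStar.star Q (Polynomial.C (MvPolynomial.C φ))
            (Polynomial.C (ProjStar.fibrePoly ψ))) =
          ProjStar.quantT Q (Polynomial.C (MvPolynomial.C φ)) *
            ProjStar.quantT Q (Polynomial.C (ProjStar.fibrePoly ψ)) ∧
        ProjStar.star Q (Polynomial.C (MvPolynomial.C φ)) (Polynomial.C (ProjStar.fibrePoly ψ)) =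
          ProjStar.gOp lam (MvPolynomial.C φ * ProjStar.fibrePoly ψ) := by
  refine ⟨⟨ProjStar.projQuant n lam, ProjStar.isEquivariantQuantization_projQuant n lam,
    fun Q hQ => ProjStar.eq_projQuant hQ⟩, fun Q hQ => ?_⟩
  obtain rfl := ProjStar.eq_projQuant hQ
  refine ⟨ProjStar.quantT_injective _, fun φ ψ => ?_⟩
  have hstar : ProjStar.star (ProjStar.projQuant n lam) (Polynomial.C (MvPolynomial.C φ))
      (Polynomial.C (ProjStar.fibrePoly ψ)) =
        ProjStar.gOp lam (MvPolynomial.C φ * ProjStar.fibrePoly ψ) := by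
    -- `Function.invFun` inverts only on the image, so the product is first exhibited as the image
    -- of `gOp`.
    rw [ProjStar.star, ← ProjStar.quantT_gOp]
    exact Function.leftInverse_invFun (ProjStar.quantT_injective _) _
  exact ⟨by rw [hstar, ProjStar.quantT_gOp], hstar⟩
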